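/- Let $\mu,\nu$ be probability measures on $\mathbb R$ with finite first moments such that $\mu<_{cx}\nu$, i.e. $\mu\ne\nu$ and $\int f\,d\mu\le\int f\,d\nu$ in $(-\infty,+\infty]$ for every convex $f:\mathbb R\to\mathbb R$. For a probability measure $\eta$ on $\mathbb R$ let $F_\eta(x)=\eta((-\infty,x])$ and $F_\eta^{-1}(u)=\inf\{x\in\mathbb R: F_\eta(x)\ge u\}$, $u\in(0,1)$. Let $d=F_\mu^{-1}-F_\nu^{-1}$, $\Psi_\pm(u)=\int_0^u d^\pm(v)\,dv$ for $u\in[0,1]$ (where $x^+=\max(x,0)$, $x^-=\max(-x,0)$), and $\gamma=\Psi_+(1)=\Psi_-(1)\in(0,\infty)$. *The set $\mathcal Q$.* Let $\mathcal Q$ be the set of probability measures $Q$ on $(0,1)^2$ with first marginal $\frac1\gamma d^+(u)\,du$, second marginal $\frac1\gamma d^-(v)\,dv$, and $Q(\{(u,v):u<v\})=1$. *The kernels $\widetilde m^Q$.* For $Q\in\mathcal Q$ let $\pi_+^Q,\pi_-^Q$ be any sub-Markov kernels on $(0,1)$ with $Q(du,dv)=\frac1\gamma d^+(u)\,du\,\pi^Q_+(u,dv)=\frac1\gamma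 d^-(v)\,dv\,\pi^Q_-(v,du)$, such that $\pi^Q_+(u,(0,1))=1$ for a.e. $u$ with $d(u)>0$ and $\pi^Q_-(v,(0,1))=1$ for a.e. $v$ with $d(v)<0$. Let $\widetilde m^Q(u,dy)$, $u\in(0,1)$, be the Markov kernel $$\int_{(0,1)}\frac{F_\mu^{-1}(u)-F_\nu^{-1}(u)}{F_\nu^{-1}(v)-F_\nu^{-1}(u)}\,\delta_{F_\nu^{-1}(v)}(dy)\,\pi(dv)+\int_{(0,1)}\frac{F_\nu^{-1}(v)-F_\mu^{-1}(u)}{F_\nu^{-1}(v)-F_\nu^{-1}(u)}\,\pi(dv)\;\delta_{F_\nu^{-1}(u)}(dy)$$ with $\pi=\pi^Q_+(u,\cdot)$ if $d(u)>0$ and $\pi^Q_+(u,\{v:F_\nu^{-1}(v)>F_\mu^{-1}(u)\})=1$; with $\pi=\pi^Q_-(u,\cdot)$ if $d(u)<0$ and $\pi^Q_-(u,\{v:F_\nu^{-1}(v)<F_\mu^{-1}(u)\})=1$; and $\widetilde m^Q(u,dy)=\delta_{F_\nu^{-1}(u)}(dy)$ otherwise. *The cost.* For $\rho\in\mathbb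 R$ and a Markov kernel $\widetilde m$ let $$\mathcal C_\rho(\widetilde m)=\int_0^1\int_{\mathbb R}|F_\nu^{-1}(u)-y|^\rho\,\mathbf 1_{\{y\ne F_\nu^{-1}(u)\}}\,\widetilde m(u,dy)\,du\in[0,+\infty].$$ (1) Let $\varphi(u)=\inf\{r\in[0,1]:\Psi_-(r)\ge\Psi_+(u)\}$ and $Q^{IT}(du,dv)=\frac1\gamma d^+(u)\,du\,\mathbf 1_{\{0<\varphi(u)<1\}}\delta_{\varphi(u)}(dv)$. Then $Q^{IT}\in\mathcal Q$ and, writing $\widetilde m^{IT}=\widetilde m^{Q^{IT}}$ (inverse transform coupling), for every $Q\in\mathcal Q$ (and any choice of the disintegrations): - $\mathcal C_\rho(\widetilde m^{IT})\le\mathcal C_\rho(\widetilde m^Q)$ for all $\rho\in(-\infty,1]\cup[2,+\infty)$; - $\mathcal C_\rho(\widetilde m^{Q})\le\mathcal C_\rho(\widetilde m^{IT})$ for all $\rho\in[1,2]$; - $\mathcal C_\rho(\widetilde m^{IT})=\mathcal C_\rho(\widetilde m^Q)$ for $\rho\in\{1,2\}$. (2) Assume that there is $p\in(0,1)$ such that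 $u\mapsto\int_0^u d(v)\,dv$ is nondecreasing on $[0,p]$ and nonincreasing on $[p,1]$. Let $\chi_-(u)=\int_{1-u}^1d^-(v)\,dv$, $\chi_+=\Psi_+$, $\Gamma(u)=\inf\{r\in[0,1]:\chi_-(r)\ge\chi_+(u)\}$ and $Q^{NIT}(du,dv)=\frac1\gamma d^+(u)\,du\,\mathbf 1_{\{\Gamma(u)>0\}}\delta_{1-\Gamma(u)}(dv)$. Then $Q^{NIT}\in\mathcal Q$ and, writing $\widetilde m^{NIT}=\widetilde m^{Q^{NIT}}$, for every $Q\in\mathcal Q$ (and any choice of the disintegrations): - $\mathcal C_\rho(\widetilde m^{Q})\le\mathcal C_\rho(\widetilde m^{NIT})$ for all $\rho\in(-\infty,1]\cup[2,+\infty)$; - $\mathcal C_\rho(\widetilde m^{NIT})\le\mathcal C_\rho(\widetilde m^{Q})$ for all $\rho\in[1,2]$; - $\mathcal C_\rho(\widetilde m^{NIT})=\mathcal C_\rho(\widetilde m^Q)$ for $\rho\in\{1,2\}$. -/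

import Mathlib

open MeasureTheory ProbabilityTheory Set
open scoped ENNReal

noncomputable section

namespace ITMC

/-- The quantile function `F_η⁻¹(u) = inf {x | F_η(x) ≥ u}`, meant for `u ∈ (0,1)`. -/
def quantile (η : Measure ℝ) (u : ℝ) : ℝ := sInf {x : ℝ | u ≤ cdf η x}

/-- The strict convex order `μ <_cx ν` for probability measures with finite first moments.
A convex `f` is bounded below by an affine function, so its integrals exist in `(-∞, +∞]`;
the inequality between them means: if the integral against `ν` is finite, so is the one against
`μ`, and the first dominates the second. -/
def StrictConvexOrder (μ ν : Measure ℝ) : Prop :=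
  (∀ f : ℝ → ℝ, ConvexOn ℝ univ f → Integrable f ν →
    Integrable f μ ∧ ∫ x, f x ∂μ ≤ ∫ x, f x ∂ν) ∧ μ ≠ ν

/-- `(F_μ⁻¹ - F_ν⁻¹)⁺`. -/
def posDiff (μ ν : Measure ℝ) (u : ℝ) : ℝ := max (quantile μ u - quantile ν u) 0

/-- `(F_μ⁻¹ - F_ν⁻¹)⁻`. -/
def negDiff (μ ν : Measure ℝ) (u : ℝ) : ℝ := max (-(quantile μ u - quantile ν u)) 0

def PsiPlus (μ ν : Measure ℝ) (u : ℝ) : ℝ := ∫ v in (0 : ℝ)..u, posDiff μ ν v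

def PsiMinus (μ ν : Measure ℝ) (u : ℝ) : ℝ := ∫ v in (0 : ℝ)..u, negDiff μ ν v

/-- `γ = ∫₀¹ (F_μ⁻¹ - F_ν⁻¹)⁺`. -/
def gam (μ ν : Measure ℝ) : ℝ := PsiPlus μ ν 1

/-- The measure `γ⁻¹ (F_μ⁻¹ - F_ν⁻¹)⁺(u) du` on `(0,1)`. -/
def marginalPlus (μ ν : Measure ℝ) : Measure ℝ :=
  (volume.restrict (Ioo (0 : ℝ) 1)).withDensity
    fun u => ENNReal.ofReal (posDiff μ ν u / gam μ ν)

/-- The measure `γ⁻¹ (F_μ⁻¹ - F_ν⁻¹)⁻(v) dv` on `(0,1)`. -/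
def marginalMinus (μ ν : Measure ℝ) : Measure ℝ :=
  (volume.restrict (Ioo (0 : ℝ) 1)).withDensity
    fun v => ENNReal.ofReal (negDiff μ ν v / gam μ ν)

/-- The set `𝒬` of probability measures on `(0,1)²` (seen as measures on `ℝ²` carried by
`(0,1)²`) with the two prescribed marginals and carried by `{u < v}`. -/
def QSet (μ ν : Measure ℝ) : Set (Measure (ℝ × ℝ)) :=
  {Q | IsProbabilityMeasure Q ∧
    Q.map Prod.fst = marginalPlus μ ν ∧
    Q.map Prod.snd = marginalMinus μ ν ∧
    Q {z | z.1 ∈ Ioo (0 : ℝ) 1 ∧ z.2 ∈ Ioo (0 : ℝ) 1 ∧ z.1 < z.2} = 1}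

/-- A choice of sub-Markov kernels `π₊`, `π₋` disintegrating `Q` with respect to its first and its
second marginal respectively, with full mass on `(0,1)` for almost every `u ∈ (0,1)` such that
`F_μ⁻¹(u) > F_ν⁻¹(u)`, respectively `v ∈ (0,1)` such that `F_μ⁻¹(v) < F_ν⁻¹(v)`. -/
structure Disintegration (μ ν : Measure ℝ) (Q : Measure (ℝ × ℝ)) where
  piPlus : Kernel ℝ ℝ
  piMinus : Kernel ℝ ℝ
  piPlus_le : ∀ u, piPlus u univ ≤ 1
  piMinus_le : ∀ v, piMinus v univ ≤ 1
  piPlus_mass : ∀ᵐ u ∂(volume.restrict (Ioo (0 : ℝ) 1)),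
    quantile ν u < quantile μ u → piPlus u (Ioo 0 1) = 1
  piMinus_mass : ∀ᵐ v ∂(volume.restrict (Ioo (0 : ℝ) 1)),
    quantile μ v < quantile ν v → piMinus v (Ioo 0 1) = 1
  eq_plus : Q = (marginalPlus μ ν).compProd piPlus
  eq_minus : Q = ((marginalMinus μ ν).compProd piMinus).map Prod.swap

/-- The measure
`∫_{v∈(0,1)} (F_μ⁻¹(u)-F_ν⁻¹(u))/(F_ν⁻¹(v)-F_ν⁻¹(u)) δ_{F_ν⁻¹(v)}(dy) π(dv)
 + ∫_{v∈(0,1)} (F_ν⁻¹(v)-F_μ⁻¹(u))/(F_ν⁻¹(v)-F_ν⁻¹(u)) π(dv) δ_{F_ν⁻¹(u)}(dy)`. -/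
def splitMeasure (μ ν : Measure ℝ) (π : Measure ℝ) (u : ℝ) : Measure ℝ :=
  ((π.restrict (Ioo 0 1)).withDensity fun v =>
      ENNReal.ofReal ((quantile μ u - quantile ν u) / (quantile ν v - quantile ν u))).map
        (quantile ν) +
    (∫⁻ v in Ioo 0 1,
      ENNReal.ofReal ((quantile ν v - quantile μ u) / (quantile ν v - quantile ν u)) ∂π) •
        Measure.dirac (quantile ν u)

/-- The points `u ∈ (0,1)` where `F_μ⁻¹(u) > F_ν⁻¹(u)` and
`π(u, {v ∈ (0,1) | F_ν⁻¹(v) > F_μ⁻¹(u)}) = 1`. -/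
def regionPlus (μ ν : Measure ℝ) (π : Kernel ℝ ℝ) : Set ℝ :=
  {u | u ∈ Ioo (0 : ℝ) 1 ∧ quantile ν u < quantile μ u ∧
    π u {v | v ∈ Ioo (0 : ℝ) 1 ∧ quantile μ u < quantile ν v} = 1}

/-- The points `u ∈ (0,1)` where `F_μ⁻¹(u) < F_ν⁻¹(u)` and
`π(u, {v ∈ (0,1) | F_ν⁻¹(v) < F_μ⁻¹(u)}) = 1`. -/
def regionMinus (μ ν : Measure ℝ) (π : Kernel ℝ ℝ) : Set ℝ :=
  {u | u ∈ Ioo (0 : ℝ) 1 ∧ quantile μ u < quantile ν u ∧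
    π u {v | v ∈ Ioo (0 : ℝ) 1 ∧ quantile ν v < quantile μ u} = 1}

lemma quantile_of_nonpos (η : Measure ℝ) {u : ℝ} (hu : u ≤ 0) : quantile η u = 0 := by
  have : {x : ℝ | u ≤ cdf η x} = univ := by
    ext x; simpa using hu.trans (cdf_nonneg η x)
  simp [quantile, this]

lemma quantile_of_one_lt (η : Measure ℝ) {u : ℝ} (hu : 1 < u) : quantile η u = 0 := by
  have : {x : ℝ | u ≤ cdf η x} = ∅ := by
    ext x; simpa using (cdf_le_one η x).trans_lt hu
  simp [quantile, this]

lemma quantile_monotoneOn (η : Measure ℝ) : MonotoneOn (quantile η) (Ioo 0 1) := by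
  intro u hu v hv huv
  refine csInf_le_csInf ?_ ?_ fun x hx => huv.trans hx
  · obtain ⟨a, ha⟩ := ((tendsto_cdf_atBot η).eventually (gt_mem_nhds hu.1)).exists
    refine ⟨a, fun x hx => ?_⟩
    by_contra! h
    exact absurd (hx.trans (monotone_cdf η h.le)) (not_le.2 ha)
  · obtain ⟨a, ha⟩ := ((tendsto_cdf_atTop η).eventually (lt_mem_nhds hv.2)).exists
    exact ⟨a, ha.le⟩

lemma measurable_quantile (η : Measure ℝ) : Measurable (quantile η) := by
  refine measurable_of_Iic fun a => ?_
  have h2 : MeasurableSet (Ioo (0 : ℝ) 1 ∩ quantile η ⁻¹' Iic a) := by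
    refine OrdConnected.measurableSet ⟨fun x hx y hy z hz => ?_⟩
    have hz' : z ∈ Ioo (0 : ℝ) 1 := ⟨hx.1.1.trans_le hz.1, hz.2.trans_lt hy.1.2⟩
    exact ⟨hz', (quantile_monotoneOn η hz' hy.1 hz.2).trans hy.2⟩
  have h3 : MeasurableSet ({1} ∩ quantile η ⁻¹' Iic a) :=
    (Set.countable_singleton (1 : ℝ)).mono inter_subset_left |>.measurableSet
  have h4 : MeasurableSet ((Iic (0 : ℝ) ∪ Ioi 1) ∩ {_u | (0 : ℝ) ≤ a}) :=
    (measurableSet_Iic.union measurableSet_Ioi).inter (MeasurableSet.const _)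
  convert (h2.union h3).union h4 using 1
  ext u
  rcases le_or_gt u 0 with h | h
  · have := quantile_of_nonpos η h
    simp [this, h, not_lt.2 h]
  rcases lt_trichotomy u 1 with h' | rfl | h'
  · simp [h, h', h.not_ge, h'.ne, h'.not_gt]
  · simp
  · have := quantile_of_one_lt η h'
    simp [this, h', h'.ne', h'.not_gt]

lemma measurableSet_regionPlus (μ ν : Measure ℝ) (π : Kernel ℝ ℝ) [IsSFiniteKernel π] :
    MeasurableSet (regionPlus μ ν π) := by
  have hμ := measurable_quantile μ
  have hν := measurable_quantile ν
  have ht : MeasurableSet {p : ℝ × ℝ | p.2 ∈ Ioo (0 : ℝ) 1 ∧ quantile μ p.1 < quantile ν p.2} :=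
    (measurable_snd measurableSet_Ioo).inter
      (measurableSet_lt (hμ.comp measurable_fst) (hν.comp measurable_snd))
  exact measurableSet_Ioo.inter ((measurableSet_lt hν hμ).inter
    (Kernel.measurable_kernel_prodMk_left (κ := π) ht (measurableSet_singleton 1)))

lemma measurableSet_regionMinus (μ ν : Measure ℝ) (π : Kernel ℝ ℝ) [IsSFiniteKernel π] :
    MeasurableSet (regionMinus μ ν π) := by
  have hμ := measurable_quantile μ
  have hν := measurable_quantile ν
  have ht : MeasurableSet {p : ℝ × ℝ | p.2 ∈ Ioo (0 : ℝ) 1 ∧ quantile ν p.2 < quantile μ p.1} :=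
    (measurable_snd measurableSet_Ioo).inter
      (measurableSet_lt (hν.comp measurable_snd) (hμ.comp measurable_fst))
  exact measurableSet_Ioo.inter ((measurableSet_lt hμ hν).inter
    (Kernel.measurable_kernel_prodMk_left (κ := π) ht (measurableSet_singleton 1)))

lemma measurable_splitMeasure (μ ν : Measure ℝ) (π : Kernel ℝ ℝ) [IsSFiniteKernel π] :
    Measurable fun u => splitMeasure μ ν (π u) u := by
  have hμ := measurable_quantile μ
  have hν := measurable_quantile ν
  have hμ1 : Measurable fun p : ℝ × ℝ => quantile μ p.1 := hμ.comp measurable_fst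
  have hν1 : Measurable fun p : ℝ × ℝ => quantile ν p.1 := hν.comp measurable_fst
  have hν2 : Measurable fun p : ℝ × ℝ => quantile ν p.2 := hν.comp measurable_snd
  refine Measure.measurable_of_measurable_coe _ fun s hs => ?_
  have hval : ∀ u, splitMeasure μ ν (π u) u s =
      (∫⁻ v, (quantile ν ⁻¹' s ∩ Ioo 0 1).indicator (fun v => ENNReal.ofReal
        ((quantile μ u - quantile ν u) / (quantile ν v - quantile ν u))) v ∂(π u)) +
      (∫⁻ v, (Ioo (0 : ℝ) 1).indicator (fun v => ENNReal.ofReal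
        ((quantile ν v - quantile μ u) / (quantile ν v - quantile ν u))) v ∂(π u)) *
        s.indicator 1 (quantile ν u) := by
    intro u
    rw [splitMeasure, Measure.add_apply, Measure.map_apply hν hs, withDensity_apply _ (hν hs),
      Measure.restrict_restrict (hν hs), Measure.smul_apply, Measure.dirac_apply' _ hs,
      lintegral_indicator ((hν hs).inter measurableSet_Ioo),
      lintegral_indicator measurableSet_Ioo, smul_eq_mul]
  simp_rw [hval]
  refine Measurable.add ?_ (Measurable.mul ?_ ?_)
  · refine Measurable.lintegral_kernel_prod_right (κ := π) ?_
    exact Measurable.indicator (s := {p : ℝ × ℝ | p.2 ∈ quantile ν ⁻¹' s ∩ Ioo 0 1})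
      (f := fun p : ℝ × ℝ => ENNReal.ofReal
        ((quantile μ p.1 - quantile ν p.1) / (quantile ν p.2 - quantile ν p.1)))
      (by fun_prop) (measurable_snd ((hν hs).inter measurableSet_Ioo))
  · refine Measurable.lintegral_kernel_prod_right (κ := π) ?_
    exact Measurable.indicator (s := {p : ℝ × ℝ | p.2 ∈ Ioo (0 : ℝ) 1})
      (f := fun p : ℝ × ℝ => ENNReal.ofReal
        ((quantile ν p.2 - quantile μ p.1) / (quantile ν p.2 - quantile ν p.1)))
      (by fun_prop) (measurable_snd measurableSet_Ioo)
  · exact (measurable_one.indicator hs).comp hν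

instance {μ ν : Measure ℝ} {Q : Measure (ℝ × ℝ)} (D : Disintegration μ ν Q) :
    IsFiniteKernel D.piPlus := ⟨1, ENNReal.one_lt_top, D.piPlus_le⟩

instance {μ ν : Measure ℝ} {Q : Measure (ℝ × ℝ)} (D : Disintegration μ ν Q) :
    IsFiniteKernel D.piMinus := ⟨1, ENNReal.one_lt_top, D.piMinus_le⟩

open Classical in
/-- The Markov kernel `m̃^Q(u, dy)` attached to (a disintegration of) `Q`. Only `u ∈ (0,1)`
matters; outside `(0,1)` the last case applies. -/
def tildeKernel {μ ν : Measure ℝ} {Q : Measure (ℝ × ℝ)} (D : Disintegration μ ν Q) :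
    Kernel ℝ ℝ where
  toFun u :=
    if u ∈ regionPlus μ ν D.piPlus then splitMeasure μ ν (D.piPlus u) u
    else if u ∈ regionMinus μ ν D.piMinus then splitMeasure μ ν (D.piMinus u) u
    else Measure.dirac (quantile ν u)
  measurable' :=
    Measurable.ite (measurableSet_regionPlus μ ν D.piPlus) (measurable_splitMeasure μ ν D.piPlus)
      (Measurable.ite (measurableSet_regionMinus μ ν D.piMinus)
        (measurable_splitMeasure μ ν D.piMinus)
        (Measure.measurable_dirac.comp (measurable_quantile ν)))

lemma splitMeasure_univ {μ ν π : Measure ℝ} {u : ℝ} (hπ : π univ ≤ 1)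
    (h : (quantile ν u < quantile μ u ∧
        π {v | v ∈ Ioo (0 : ℝ) 1 ∧ quantile μ u < quantile ν v} = 1) ∨
      (quantile μ u < quantile ν u ∧
        π {v | v ∈ Ioo (0 : ℝ) 1 ∧ quantile ν v < quantile μ u} = 1)) :
    splitMeasure μ ν π u univ = 1 := by
  have hν := measurable_quantile ν
  have : IsFiniteMeasure π := ⟨hπ.trans_lt ENNReal.one_lt_top⟩
  have key : ∀ A : Set ℝ, MeasurableSet A → A ⊆ Ioo 0 1 → π A = 1 →
      (∀ v ∈ A, 0 ≤ (quantile μ u - quantile ν u) / (quantile ν v - quantile ν u) ∧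
        0 ≤ (quantile ν v - quantile μ u) / (quantile ν v - quantile ν u) ∧
        quantile ν v - quantile ν u ≠ 0) → splitMeasure μ ν π u univ = 1 := by
    intro A hA hsub hA1 hr
    have hAc : π Aᶜ = 0 := by
      rw [measure_compl hA (measure_ne_top _ _), hA1]
      exact tsub_eq_zero_of_le hπ
    have hae : ∀ᵐ v ∂π, v ∈ A := hAc
    have hres : π.restrict (Ioo 0 1) = π :=
      Measure.restrict_eq_self_of_ae_mem (hae.mono fun v hv => hsub hv)
    have hm : Measurable fun v => ENNReal.ofReal
        ((quantile μ u - quantile ν u) / (quantile ν v - quantile ν u)) := by fun_prop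
    rw [splitMeasure, hres, Measure.add_apply, Measure.map_apply hν MeasurableSet.univ,
      preimage_univ, withDensity_apply _ MeasurableSet.univ, Measure.restrict_univ,
      Measure.smul_apply, Measure.dirac_apply_of_mem (mem_univ _), smul_eq_mul, mul_one,
      ← lintegral_add_left hm]
    have hone : ∀ᵐ v ∂π, ENNReal.ofReal
        ((quantile μ u - quantile ν u) / (quantile ν v - quantile ν u)) + ENNReal.ofReal
        ((quantile ν v - quantile μ u) / (quantile ν v - quantile ν u)) = 1 := by
      filter_upwards [hae] with v hv
      obtain ⟨h1, h2, h3⟩ := hr v hv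
      rw [← ENNReal.ofReal_add h1 h2, ← add_div, sub_add_sub_cancel', div_self h3,
        ENNReal.ofReal_one]
    rw [lintegral_congr_ae hone, lintegral_one]
    exact le_antisymm hπ (hA1 ▸ measure_mono (subset_univ A))
  rcases h with ⟨h1, h2⟩ | ⟨h1, h2⟩
  · refine key _ (measurableSet_Ioo.inter (measurableSet_lt measurable_const hν))
      (fun v hv => hv.1) h2 fun v hv => ?_
    have hv2 : quantile μ u < quantile ν v := hv.2
    exact ⟨div_nonneg (by linarith) (by linarith), div_nonneg (by linarith) (by linarith),
      by linarith⟩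
  · refine key _ (measurableSet_Ioo.inter (measurableSet_lt hν measurable_const))
      (fun v hv => hv.1) h2 fun v hv => ?_
    have hv2 : quantile ν v < quantile μ u := hv.2
    exact ⟨div_nonneg_of_nonpos (by linarith) (by linarith),
      div_nonneg_of_nonpos (by linarith) (by linarith), by linarith⟩

instance {μ ν : Measure ℝ} {Q : Measure (ℝ × ℝ)} (D : Disintegration μ ν Q) :
    IsMarkovKernel (tildeKernel D) := by
  classical
  refine ⟨fun u => ⟨?_⟩⟩
  change (if u ∈ regionPlus μ ν D.piPlus then splitMeasure μ ν (D.piPlus u) u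
    else if u ∈ regionMinus μ ν D.piMinus then splitMeasure μ ν (D.piMinus u) u
    else Measure.dirac (quantile ν u)) univ = 1
  split_ifs with h h'
  · exact splitMeasure_univ (D.piPlus_le u) (Or.inl h.2)
  · exact splitMeasure_univ (D.piMinus_le u) (Or.inr h'.2)
  · simp

/-- Every `Q ∈ 𝒬` has a disintegration. -/
lemma nonempty_disintegration {μ ν : Measure ℝ} {Q : Measure (ℝ × ℝ)} (hQ : Q ∈ QSet μ ν) :
    Nonempty (Disintegration μ ν Q) := by
  obtain ⟨hprob, h1, h2, h3⟩ := hQ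
  have hμ := measurable_quantile μ
  have hν := measurable_quantile ν
  have hS : MeasurableSet {z : ℝ × ℝ | z.1 ∈ Ioo (0 : ℝ) 1 ∧ z.2 ∈ Ioo (0 : ℝ) 1 ∧ z.1 < z.2} :=
    (measurable_fst measurableSet_Ioo).inter
      ((measurable_snd measurableSet_Ioo).inter (measurableSet_lt measurable_fst measurable_snd))
  have hae : ∀ᵐ z ∂Q, z.1 ∈ Ioo (0 : ℝ) 1 ∧ z.2 ∈ Ioo (0 : ℝ) 1 ∧ z.1 < z.2 :=
    (prob_compl_eq_zero_iff hS).2 h3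
  have hgam0 : 0 ≤ gam μ ν :=
    intervalIntegral.integral_nonneg zero_le_one fun u _ => le_max_right _ _
  have hgam : 0 < gam μ ν := by
    refine lt_of_le_of_ne hgam0 fun h0 => ?_
    have hz : Q.map Prod.fst = 0 := by simp [h1, marginalPlus, ← h0]
    have := congrArg (fun m => m univ) hz
    simp [Measure.map_apply measurable_fst MeasurableSet.univ] at this
  have mass : ∀ (P : Measure (ℝ × ℝ)) [IsProbabilityMeasure P] (f : ℝ → ℝ), Measurable f →
      P.fst = (volume.restrict (Ioo (0 : ℝ) 1)).withDensity
        (fun u => ENNReal.ofReal (f u / gam μ ν)) →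
      (∀ᵐ z ∂P, z.2 ∈ Ioo (0 : ℝ) 1) →
      ∀ᵐ u ∂(volume.restrict (Ioo (0 : ℝ) 1)), 0 < f u → P.condKernel u (Ioo 0 1) = 1 := by
    intro P _ f hf hP hP2
    rw [← P.disintegrate P.condKernel] at hP2
    have h4 := Measure.ae_ae_of_ae_compProd hP2
    rw [hP, ae_withDensity_iff (by fun_prop)] at h4
    filter_upwards [h4] with u hu hfu
    refine (prob_compl_eq_zero_iff measurableSet_Ioo).1 (hu ?_)
    simpa using div_pos hfu hgam
  have hsw : IsProbabilityMeasure (Q.map Prod.swap) :=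
    Measure.isProbabilityMeasure_map measurable_swap.aemeasurable
  have hfst : (Q.map Prod.swap).fst = marginalMinus μ ν := by
    rw [← h2, Measure.fst_map_swap]; rfl
  have hp : Measurable (posDiff μ ν) := (hμ.sub hν).max measurable_const
  have hm : Measurable (negDiff μ ν) := (hμ.sub hν).neg.max measurable_const
  refine ⟨⟨Q.condKernel, (Q.map Prod.swap).condKernel, fun u => prob_le_one,
    fun u => prob_le_one, ?_, ?_, ?_, ?_⟩⟩
  · filter_upwards [mass Q (posDiff μ ν) hp h1 (hae.mono fun z hz => hz.2.1)] with u hu h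
    exact hu (lt_max_of_lt_left (sub_pos.2 h))
  · have hsae : ∀ᵐ z ∂(Q.map Prod.swap), z.2 ∈ Ioo (0 : ℝ) 1 :=
      (ae_map_iff measurable_swap.aemeasurable (measurable_snd measurableSet_Ioo)).2
        (hae.mono fun z hz => hz.1)
    filter_upwards [mass (Q.map Prod.swap) (negDiff μ ν) hm hfst hsae] with u hu h
    exact hu (lt_max_of_lt_left (by linarith))
  · rw [← h1]; exact (Q.disintegrate Q.condKernel).symm
  · rw [← hfst, (Q.map Prod.swap).disintegrate, Measure.map_map measurable_swap measurable_swap]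
    simp

/-- `𝒞_ρ(m̃) = ∫_{(0,1)} ∫_ℝ |F_ν⁻¹(u) - y|^ρ 1_{y ≠ F_ν⁻¹(u)} m̃(u, dy) du`, in `[0, +∞]`. -/
def cost (ν : Measure ℝ) (ρ : ℝ) (m : Kernel ℝ ℝ) : ℝ≥0∞ :=
  ∫⁻ u in Ioo (0 : ℝ) 1, ∫⁻ y,
    ({y | y ≠ quantile ν u} : Set ℝ).indicator
      (fun y => ENNReal.ofReal (|quantile ν u - y| ^ ρ)) y ∂(m u)

/-- `φ(u) = Ψ₋⁻¹(Ψ₊(u)) = inf {r ∈ [0,1] | Ψ₋(r) ≥ Ψ₊(u)}`. -/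
def phi (μ ν : Measure ℝ) (u : ℝ) : ℝ :=
  sInf {r | r ∈ Icc (0 : ℝ) 1 ∧ PsiPlus μ ν u ≤ PsiMinus μ ν r}

/-- `Q^{IT}(du, dv) = γ⁻¹ (F_μ⁻¹ - F_ν⁻¹)⁺(u) du 1_{0 < φ(u) < 1} δ_{φ(u)}(dv)`. -/
def QIT (μ ν : Measure ℝ) : Measure (ℝ × ℝ) :=
  ((marginalPlus μ ν).restrict {u | 0 < phi μ ν u ∧ phi μ ν u < 1}).map fun u => (u, phi μ ν u)

/-- `χ₋(u) = ∫_{1-u}^1 (F_μ⁻¹ - F_ν⁻¹)⁻`. -/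
def chiMinus (μ ν : Measure ℝ) (u : ℝ) : ℝ := ∫ v in (1 - u)..1, negDiff μ ν v

/-- `χ₊(u) = ∫_0^u (F_μ⁻¹ - F_ν⁻¹)⁺`. -/
def chiPlus (μ ν : Measure ℝ) (u : ℝ) : ℝ := ∫ v in (0 : ℝ)..u, posDiff μ ν v

/-- `Γ(u) = χ₋⁻¹(χ₊(u)) = inf {r ∈ [0,1] | χ₋(r) ≥ χ₊(u)}`. -/
def Gam (μ ν : Measure ℝ) (u : ℝ) : ℝ :=
  sInf {r | r ∈ Icc (0 : ℝ) 1 ∧ chiPlus μ ν u ≤ chiMinus μ ν r}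

/-- `Q^{NIT}(du, dv) = γ⁻¹ (F_μ⁻¹ - F_ν⁻¹)⁺(u) du 1_{Γ(u) > 0} δ_{1 - Γ(u)}(dv)`. -/
def QNIT (μ ν : Measure ℝ) : Measure (ℝ × ℝ) :=
  ((marginalPlus μ ν).restrict {u | 0 < Gam μ ν u}).map fun u => (u, 1 - Gam μ ν u)

/-- The difference of the quantile functions changes sign only once. -/
def SingleSignChange (μ ν : Measure ℝ) : Prop :=
  ∃ p ∈ Ioo (0 : ℝ) 1,
    MonotoneOn (fun u => ∫ v in (0 : ℝ)..u, (quantile μ v - quantile ν v)) (Icc 0 p) ∧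
    AntitoneOn (fun u => ∫ v in (0 : ℝ)..u, (quantile μ v - quantile ν v)) (Icc p 1)

end ITMC

end

/-!
The primitive of `F_η⁻¹` is the Legendre transform of `x ↦ ∫ (x - y)⁺ η(dy)`, so the convex order
makes the primitive of `d = F_μ⁻¹ - F_ν⁻¹` nonnegative.

Every `Q ∈ 𝒬` is carried by pairs `u < v` with
`F_ν⁻¹(u) < F_μ⁻¹(u) ≤ F_μ⁻¹(v) < F_ν⁻¹(v)`. Hence the kernel `m̃^Q` always splits mass between two
points, and both halves of its cost are computed by `Q`:
`𝒞_ρ(m̃^Q) = 2γ ∫ (F_ν⁻¹(v) - F_ν⁻¹(u))^(ρ-1) Q(du, dv)`.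

The couplings in `𝒬` share their marginals. Among such couplings, a larger distribution function
means a smaller integral of `(b - a)^(ρ-1)` for `ρ < 1` or `ρ > 2` and a larger one for `1 < ρ < 2`:
the power is, up to a constant, a superposition over `t > 0` with weight `t^(ρ-3)` of
`(t - (b - a))⁺`, `(b - a - t)⁺` and `min t (b - a)` respectively, and each of these is the length
of a set of `s` whose probability under the coupling involves its distribution function at one
point only. The inverse transform coupling is comonotone and has the largest distribution function;
the nonincreasing one is countermonotone and has the smallest.
-/

namespace ITMC

section Quantile

lemma quantile_le_iff (η : Measure ℝ) {u : ℝ} (hu : u ∈ Ioo (0 : ℝ) 1) (x : ℝ) :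
    quantile η u ≤ x ↔ u ≤ cdf η x := by
  obtain ⟨a, ha⟩ := ((tendsto_cdf_atBot η).eventually (gt_mem_nhds hu.1)).exists
  obtain ⟨b, hb⟩ := ((tendsto_cdf_atTop η).eventually (lt_mem_nhds hu.2)).exists
  have hbdd : BddBelow {x : ℝ | u ≤ cdf η x} :=
    ⟨a, fun y hy => le_of_not_gt fun h => (ha.trans_le hy).not_ge (monotone_cdf η h.le)⟩
  refine ⟨fun h => ?_, fun h => csInf_le hbdd h⟩
  have hlt : ∀ y ∈ Ioi x, u ≤ cdf η y := fun y hy => by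
    obtain ⟨z, hz, hzy⟩ := exists_lt_of_csInf_lt ⟨b, hb.le⟩ (h.trans_lt hy)
    exact hz.trans (monotone_cdf η hzy.le)
  exact ge_of_tendsto (((cdf η).right_continuous x).mono Ioi_subset_Ici_self)
    (eventually_nhdsWithin_of_forall hlt)

lemma volume_restrict_Ioo_Iic {c : ℝ} (hc : c ≤ 1) :
    volume.restrict (Ioo (0 : ℝ) 1) (Iic c) = ENNReal.ofReal c := by
  rw [restrict_Ioo_eq_restrict_Ioc, Measure.restrict_apply measurableSet_Iic, inter_comm,
    Ioc_inter_Iic, min_eq_right hc, Real.volume_Ioc, sub_zero]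

lemma map_quantile (η : Measure ℝ) [IsProbabilityMeasure η] :
    (volume.restrict (Ioo (0 : ℝ) 1)).map (quantile η) = η := by
  refine Measure.ext_of_Iic _ _ fun x => ?_
  rw [Measure.map_apply (measurable_quantile η) measurableSet_Iic, ← ofReal_cdf,
    ← volume_restrict_Ioo_Iic (cdf_le_one η x)]
  refine measure_congr ?_
  filter_upwards [ae_restrict_mem measurableSet_Ioo] with u hu
  exact propext (quantile_le_iff η hu x)

variable {η : Measure ℝ} [IsProbabilityMeasure η]

lemma integrableOn_comp_quantile {g : ℝ → ℝ} (hg : Integrable g η) :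
    IntegrableOn (fun u => g (quantile η u)) (Ioo 0 1) := by
  rw [← map_quantile η] at hg
  exact hg.comp_measurable (measurable_quantile η)

lemma intervalIntegrable_quantile (h : Integrable (fun x : ℝ => x) η) :
    IntervalIntegrable (quantile η) volume 0 1 :=
  (intervalIntegrable_iff_integrableOn_Ioo_of_le zero_le_one).2 (integrableOn_comp_quantile h)

lemma integral_comp_quantile {g : ℝ → ℝ} (hg : AEStronglyMeasurable g η) :
    ∫ u in (0 : ℝ)..1, g (quantile η u) = ∫ x, g x ∂η := by
  rw [intervalIntegral.integral_of_le zero_le_one, integral_Ioc_eq_integral_Ioo,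
    ← integral_map (measurable_quantile η).aemeasurable (by rwa [map_quantile]), map_quantile]

lemma quantile_eq_sInf_of_ae_mem_Icc {a b u : ℝ} (hη : ∀ᵐ x ∂η, x ∈ Icc a b)
    (hu : u ∈ Ioo (0 : ℝ) 1) :
    quantile η u = sInf {r | r ∈ Icc a b ∧ u ≤ cdf η r} := by
  have hleast : quantile η u ∈ Icc a b → IsLeast {r | r ∈ Icc a b ∧ u ≤ cdf η r} (quantile η u) :=
    fun h => ⟨⟨h, (quantile_le_iff η hu _).1 le_rfl⟩, fun r hr => (quantile_le_iff η hu r).2 hr.2⟩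
  refine (hleast ⟨?_, ?_⟩).csInf_eq.symm
  · by_contra! h
    have hnull : η (Iic (quantile η u)) = 0 :=
      measure_eq_zero_iff_ae_notMem.2 (hη.mono fun x hx hxq => (hx.1.trans hxq).not_gt h)
    have hle := (quantile_le_iff η hu _).1 le_rfl
    rw [cdf_eq_real, measureReal_def, hnull, ENNReal.toReal_zero] at hle
    exact hle.not_gt hu.1
  · have hfull : η (Iic b) = 1 :=
      (mem_ae_iff_prob_eq_one measurableSet_Iic).1 (hη.mono fun x hx => hx.2)
    rw [quantile_le_iff η hu, cdf_eq_real, measureReal_def, hfull, ENNReal.toReal_one]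
    exact hu.2.le

end Quantile

section Transport

variable {P P' : Measure ℝ} [IsProbabilityMeasure P]

lemma cdf_quantile [NullSingletonClass P] {u : ℝ} (hu : u ∈ Ioo (0 : ℝ) 1) :
    cdf P (quantile P u) = u := by
  refine le_antisymm ((ENNReal.ofReal_le_ofReal_iff hu.1.le).1 ?_)
    ((quantile_le_iff P hu _).1 le_rfl)
  calc ENNReal.ofReal (cdf P (quantile P u)) = P (Iio (quantile P u)) := by
        rw [ofReal_cdf, measure_congr Iio_ae_eq_Iic]
    _ = volume.restrict (Ioo 0 1) (quantile P ⁻¹' Iio (quantile P u)) := by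
        rw [← Measure.map_apply (measurable_quantile P) measurableSet_Iio, map_quantile]
    _ ≤ volume.restrict (Ioo 0 1) (Iic u) := by
        refine measure_mono_ae ?_
        filter_upwards [ae_restrict_mem measurableSet_Ioo] with w hw hwu
        exact le_of_not_gt fun h => (quantile_monotoneOn P hu hw h.le).not_gt hwu
    _ = ENNReal.ofReal u := volume_restrict_Ioo_Iic hu.2.le

lemma map_cdf [NullSingletonClass P] : P.map (cdf P) = volume.restrict (Ioo (0 : ℝ) 1) := by
  have hcdf : Measurable (cdf P) := (monotone_cdf P).measurable
  calc P.map (cdf P) = (volume.restrict (Ioo (0 : ℝ) 1)).map (cdf P ∘ quantile P) := by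
        rw [← Measure.map_map hcdf (measurable_quantile P), map_quantile]
    _ = (volume.restrict (Ioo (0 : ℝ) 1)).map id :=
        Measure.map_congr ((ae_restrict_mem measurableSet_Ioo).mono fun _ hu => cdf_quantile hu)
    _ = volume.restrict (Ioo (0 : ℝ) 1) := Measure.map_id

lemma ae_cdf_mem_Ioo [NullSingletonClass P] : ∀ᵐ u ∂P, cdf P u ∈ Ioo (0 : ℝ) 1 :=
  ae_of_ae_map (monotone_cdf P).measurable.aemeasurable
    (by rw [map_cdf]; exact ae_restrict_mem measurableSet_Ioo)

/-- The increasing rearrangement `F_{P'}⁻¹ ∘ F_P`: the monotone map pushing an atomless `P`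
to `P'`. Its values where `F_P` is `0` or `1` carry no meaning. -/
noncomputable def monotoneTransport (P P' : Measure ℝ) (u : ℝ) : ℝ := quantile P' (cdf P u)

lemma measurable_monotoneTransport (P P' : Measure ℝ) : Measurable (monotoneTransport P P') :=
  (measurable_quantile P').comp (monotone_cdf P).measurable

lemma monotoneOn_monotoneTransport (P P' : Measure ℝ) :
    MonotoneOn (monotoneTransport P P') {u | cdf P u ∈ Ioo (0 : ℝ) 1} :=
  fun _ hu _ hv huv => quantile_monotoneOn P' hu hv (monotone_cdf P huv)

lemma map_monotoneTransport [NullSingletonClass P] [IsProbabilityMeasure P'] :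
    P.map (monotoneTransport P P') = P' := by
  change P.map (quantile P' ∘ cdf P) = P'
  rw [← Measure.map_map (measurable_quantile P') (monotone_cdf P).measurable, map_cdf,
    map_quantile]

/-- The decreasing rearrangement: the monotone transport from `P` to the reflection of `P'` under
`u ↦ 1 - u`, reflected back. The reflection point is the one of the unit interval, on which `P'`
lives in the application. -/
noncomputable def antitoneTransport (P P' : Measure ℝ) (u : ℝ) : ℝ :=
  1 - monotoneTransport P (P'.map fun v => 1 - v) u

lemma measurable_antitoneTransport (P P' : Measure ℝ) : Measurable (antitoneTransport P P') :=
  (measurable_monotoneTransport _ _).const_sub 1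

lemma antitoneOn_antitoneTransport (P P' : Measure ℝ) :
    AntitoneOn (antitoneTransport P P') {u | cdf P u ∈ Ioo (0 : ℝ) 1} :=
  fun _ hu _ hv huv => sub_le_sub_left (monotoneOn_monotoneTransport _ _ hu hv huv) 1

lemma map_antitoneTransport [NullSingletonClass P] [IsProbabilityMeasure P'] :
    P.map (antitoneTransport P P') = P' := by
  have hr : Measurable fun v : ℝ => 1 - v := by fun_prop
  have := Measure.isProbabilityMeasure_map (μ := P') hr.aemeasurable
  change P.map ((fun v => 1 - v) ∘ monotoneTransport P (P'.map fun v => 1 - v)) = P'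
  rw [← Measure.map_map hr (measurable_monotoneTransport _ _), map_monotoneTransport,
    Measure.map_map hr hr]
  simp only [Function.comp_def, sub_sub_cancel, Measure.map_id']

end Transport

section ScaledDensity

/-- The measure `c⁻¹ f(u) du` on `(0,1)`, the common form of the two marginals of an element of
`QSet`. -/
noncomputable def scaledDensity (f : ℝ → ℝ) (c : ℝ) : Measure ℝ :=
  (volume.restrict (Ioo (0 : ℝ) 1)).withDensity fun u => ENNReal.ofReal (f u / c)

variable {f : ℝ → ℝ} {c : ℝ}

instance : SFinite (scaledDensity f c) := by unfold scaledDensity; infer_instance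

instance : NullSingletonClass (scaledDensity f c) := by unfold scaledDensity; infer_instance

lemma ae_mem_Ioo_scaledDensity : ∀ᵐ u ∂scaledDensity f c, u ∈ Ioo (0 : ℝ) 1 :=
  (withDensity_absolutelyContinuous _ _).ae_le (ae_restrict_mem measurableSet_Ioo)

lemma ae_scaledDensity_iff (hf : Measurable f) (hc : 0 < c) {p : ℝ → Prop} :
    (∀ᵐ u ∂scaledDensity f c, p u) ↔ ∀ᵐ u ∂volume.restrict (Ioo (0 : ℝ) 1), 0 < f u → p u := by
  rw [scaledDensity, ae_withDensity_iff (by fun_prop)]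
  simp only [ne_eq, ENNReal.ofReal_eq_zero, not_le, div_pos_iff_of_pos_right hc]

lemma setLIntegral_mul_lintegral_kernel (hf : Measurable f) (hc : 0 < c) (κ : Kernel ℝ ℝ)
    [IsSFiniteKernel κ] {K : ℝ × ℝ → ℝ≥0∞} (hK : Measurable K) :
    ∫⁻ u in Ioo (0 : ℝ) 1, ENNReal.ofReal (f u) * ∫⁻ v, K (u, v) ∂κ u =
      ENNReal.ofReal c * ∫⁻ z, K z ∂(scaledDensity f c).compProd κ := by
  rw [Measure.lintegral_compProd hK, scaledDensity,
    lintegral_withDensity_eq_lintegral_mul _ (by fun_prop) hK.lintegral_kernel_prod_right',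
    ← lintegral_const_mul' _ _ ENNReal.ofReal_ne_top]
  refine lintegral_congr fun u => ?_
  rw [Pi.mul_apply, ← mul_assoc, ← ENNReal.ofReal_mul hc.le, mul_div_cancel₀ _ hc.ne']

lemma scaledDensity_Ioc (hf : ∀ u, 0 ≤ f u) (hi : IntervalIntegrable f volume 0 1) (hc : 0 ≤ c)
    {a b : ℝ} (ha : 0 ≤ a) (hab : a ≤ b) (hb : b ≤ 1) :
    scaledDensity f c (Ioc a b) = ENNReal.ofReal ((∫ u in a..b, f u) / c) := by
  have hint : IntegrableOn f (Ioc a b) :=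
    ((intervalIntegrable_iff_integrableOn_Ioc_of_le zero_le_one).1 hi).mono_set
      (Ioc_subset_Ioc ha hb)
  rw [scaledDensity, withDensity_apply _ measurableSet_Ioc, restrict_Ioo_eq_restrict_Ioc,
    Measure.restrict_restrict measurableSet_Ioc, inter_eq_left.2 (Ioc_subset_Ioc ha hb),
    ← ofReal_integral_eq_lintegral_ofReal (hint.div_const c)
      (Filter.Eventually.of_forall fun u => div_nonneg (hf u) hc),
    integral_div, intervalIntegral.integral_of_le hab]

lemma isProbabilityMeasure_scaledDensity (hf : ∀ u, 0 ≤ f u) (hc : 0 < c)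
    (h1 : ∫ u in (0 : ℝ)..1, f u = c) : IsProbabilityMeasure (scaledDensity f c) := by
  have hi : IntervalIntegrable f volume 0 1 := by
    by_contra hi
    exact hc.ne (h1 ▸ (intervalIntegral.integral_undef hi).symm)
  refine ⟨?_⟩
  have hIoc : scaledDensity f c univ = scaledDensity f c (Ioc 0 1) :=
    measure_congr (ae_mem_Ioo_scaledDensity.mono fun u hu =>
      propext (iff_of_true trivial ⟨hu.1, hu.2.le⟩))
  rw [hIoc, scaledDensity_Ioc hf hi hc.le le_rfl zero_le_one le_rfl, h1, div_self hc.ne',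
    ENNReal.ofReal_one]

lemma cdf_scaledDensity [IsProbabilityMeasure (scaledDensity f c)] (hf : ∀ u, 0 ≤ f u)
    (hi : IntervalIntegrable f volume 0 1) (hc : 0 ≤ c) {r : ℝ} (hr : r ∈ Icc (0 : ℝ) 1) :
    cdf (scaledDensity f c) r = (∫ u in (0 : ℝ)..r, f u) / c := by
  have hIoc : scaledDensity f c (Iic r) = scaledDensity f c (Ioc 0 r) :=
    measure_congr (ae_mem_Ioo_scaledDensity.mono fun u hu =>
      propext ⟨fun h => ⟨hu.1, h⟩, fun h => h.2⟩)
  rw [cdf_eq_real, measureReal_def, hIoc, scaledDensity_Ioc hf hi hc le_rfl hr.1 hr.2,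
    ENNReal.toReal_ofReal (div_nonneg (intervalIntegral.integral_nonneg hr.1 fun u _ => hf u) hc)]

lemma cdf_map_one_sub_scaledDensity (hf : ∀ u, 0 ≤ f u) (hi : IntervalIntegrable f volume 0 1)
    (hc : 0 ≤ c) [IsProbabilityMeasure ((scaledDensity f c).map fun u => 1 - u)] {r : ℝ}
    (hr : r ∈ Icc (0 : ℝ) 1) :
    cdf ((scaledDensity f c).map fun u => 1 - u) r = (∫ u in (1 - r)..1, f u) / c := by
  have hIoc : scaledDensity f c ((fun u => 1 - u) ⁻¹' Iic r) =
      scaledDensity f c (Ioc (1 - r) 1) := by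
    refine measure_congr ?_
    filter_upwards [ae_mem_Ioo_scaledDensity, Measure.ae_ne (scaledDensity f c) (1 - r)]
      with u hu hne
    exact propext ⟨fun h => ⟨(sub_le_comm.1 h).lt_of_ne' hne, hu.2.le⟩,
      fun h => sub_le_comm.1 h.1.le⟩
  rw [cdf_eq_real, measureReal_def, Measure.map_apply (by fun_prop) measurableSet_Iic, hIoc,
    scaledDensity_Ioc hf hi hc (sub_nonneg.2 hr.2) (sub_le_self _ hr.1) le_rfl,
    ENNReal.toReal_ofReal (div_nonneg
      (intervalIntegral.integral_nonneg (sub_le_self _ hr.1) fun u _ => hf u) hc)]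

end ScaledDensity

section LegendreDuality

variable {q : ℝ → ℝ} {a b u : ℝ}

lemma mul_sub_integral_posPart_le (hq : IntervalIntegrable q volume a b) (hu : u ∈ Icc a b)
    (x : ℝ) : (u - a) * x - ∫ w in a..b, max (x - q w) 0 ≤ ∫ w in a..u, q w := by
  have hsub : uIcc a u ⊆ uIcc a b := uIcc_subset_uIcc left_mem_uIcc (Icc_subset_uIcc hu)
  have hqu : IntervalIntegrable q volume a u := hq.mono_set hsub
  have hpos : IntervalIntegrable (fun w => max (x - q w) 0) volume a b :=
    ⟨(intervalIntegrable_const.sub hq).1.pos_part, (intervalIntegrable_const.sub hq).2.pos_part⟩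
  have hle : ∫ w in a..u, (x - q w) ≤ ∫ w in a..b, max (x - q w) 0 :=
    calc ∫ w in a..u, (x - q w) ≤ ∫ w in a..u, max (x - q w) 0 :=
          intervalIntegral.integral_mono_on hu.1 (intervalIntegrable_const.sub hqu)
            (hpos.mono_set hsub) fun _ _ => le_max_left _ _
      _ ≤ ∫ w in a..b, max (x - q w) 0 :=
          intervalIntegral.integral_mono_interval le_rfl hu.1 hu.2
            (Filter.Eventually.of_forall fun _ => le_max_right _ _) hpos
  rw [intervalIntegral.integral_sub intervalIntegrable_const hqu,
    intervalIntegral.integral_const, smul_eq_mul] at hle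
  linarith

lemma integral_eq_mul_sub_integral_posPart (hq : IntervalIntegrable q volume a b)
    (hmono : MonotoneOn q (Ioo a b)) (hu : u ∈ Ioo a b) :
    ∫ w in a..u, q w = (u - a) * q u - ∫ w in a..b, max (q u - q w) 0 := by
  have huI : u ∈ uIcc a b := Icc_subset_uIcc (Ioo_subset_Icc_self hu)
  have hpos : IntervalIntegrable (fun w => max (q u - q w) 0) volume a b :=
    ⟨(intervalIntegrable_const.sub hq).1.pos_part, (intervalIntegrable_const.sub hq).2.pos_part⟩
  have hqu : IntervalIntegrable q volume a u := hq.mono_set (uIcc_subset_uIcc left_mem_uIcc huI)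
  have hleft : ∫ w in a..u, max (q u - q w) 0 = ∫ w in a..u, (q u - q w) :=
    intervalIntegral.integral_congr_Ioo_of_le hu.1.le fun w hw =>
      max_eq_left (sub_nonneg.2 (hmono ⟨hw.1, hw.2.trans hu.2⟩ hu hw.2.le))
  have hright : ∫ w in u..b, max (q u - q w) 0 = ∫ _ in u..b, (0 : ℝ) :=
    intervalIntegral.integral_congr_Ioo_of_le hu.2.le fun w hw =>
      max_eq_right (sub_nonpos.2 (hmono hu ⟨hu.1.trans hw.1, hw.2⟩ hw.1.le))
  rw [← intervalIntegral.integral_add_adjacent_intervals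
      (hpos.mono_set (uIcc_subset_uIcc left_mem_uIcc huI))
      (hpos.mono_set (uIcc_subset_uIcc huI right_mem_uIcc)),
    hleft, hright, intervalIntegral.integral_sub intervalIntegrable_const hqu,
    intervalIntegral.integral_const, intervalIntegral.integral_zero, smul_eq_mul]
  ring

end LegendreDuality

namespace StrictConvexOrder

variable {μ ν : Measure ℝ}

lemma integral_eq (hcx : StrictConvexOrder μ ν) (hν : Integrable (fun x : ℝ => x) ν) :
    ∫ x, x ∂μ = ∫ x, x ∂ν := by
  refine le_antisymm (hcx.1 _ (convexOn_id convex_univ) hν).2 ?_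
  have hneg := (hcx.1 (fun x => -x) (concaveOn_id convex_univ).neg hν.neg).2
  rwa [integral_neg, integral_neg, neg_le_neg_iff] at hneg

variable [IsProbabilityMeasure μ] [IsProbabilityMeasure ν]

lemma integral_quantile_eq (hcx : StrictConvexOrder μ ν) (hν : Integrable (fun x : ℝ => x) ν) :
    ∫ w in (0 : ℝ)..1, quantile μ w = ∫ w in (0 : ℝ)..1, quantile ν w := by
  rw [integral_comp_quantile (η := μ) (g := fun x => x) (by fun_prop),
    integral_comp_quantile (η := ν) (g := fun x => x) (by fun_prop), hcx.integral_eq hν]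

lemma integral_quantile_le (hcx : StrictConvexOrder μ ν) (hμ : Integrable (fun x : ℝ => x) μ)
    (hν : Integrable (fun x : ℝ => x) ν) {u : ℝ} (hu : u ∈ Icc (0 : ℝ) 1) :
    ∫ w in (0 : ℝ)..u, quantile ν w ≤ ∫ w in (0 : ℝ)..u, quantile μ w := by
  rcases hu.1.eq_or_lt with rfl | h0
  · simp
  rcases hu.2.eq_or_lt with rfl | h1
  · exact (hcx.integral_quantile_eq hν).ge
  set x := quantile ν u
  have hput (η : Measure ℝ) [IsProbabilityMeasure η] :
      ∫ w in (0 : ℝ)..1, max (x - quantile η w) 0 = ∫ y, max (x - y) 0 ∂η :=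
    integral_comp_quantile (g := fun y => max (x - y) 0) (by fun_prop)
  have hconv : ConvexOn ℝ univ (fun y : ℝ => max (x - y) 0) :=
    ((convexOn_const _ convex_univ).sub (concaveOn_id convex_univ)).sup
      (convexOn_const 0 convex_univ)
  calc ∫ w in (0 : ℝ)..u, quantile ν w = (u - 0) * x - ∫ y, max (x - y) 0 ∂ν := by
        rw [← hput, integral_eq_mul_sub_integral_posPart (intervalIntegrable_quantile hν)
          (quantile_monotoneOn ν) ⟨h0, h1⟩]
    _ ≤ (u - 0) * x - ∫ y, max (x - y) 0 ∂μ :=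
        sub_le_sub_left (hcx.1 _ hconv ((integrable_const x).sub hν).pos_part).2 _
    _ ≤ ∫ w in (0 : ℝ)..u, quantile μ w := by
        rw [← hput]
        exact mul_sub_integral_posPart_le (intervalIntegrable_quantile hμ) hu x

end StrictConvexOrder

section LayerCake

variable {α β : Type*} [MeasurableSpace α] [MeasurableSpace β]

/-- Both sides of the comparison of the integrals of `z ↦ W(S_z)` are products `P ⊗ W`, `P' ⊗ W`
evaluated at `S`, which may be computed by integrating the other sections first. -/
lemma lintegral_le_of_section_le {P P' : Measure α} [SFinite P] [SFinite P'] {W : Measure β}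
    [SFinite W] {S : Set (α × β)} (hS : MeasurableSet S) {h : α → ℝ≥0∞} {c : ℝ≥0∞}
    (hc0 : c ≠ 0) (hc : c ≠ ∞)
    (hP : ∀ᵐ z ∂P, W (Prod.mk z ⁻¹' S) = h z * c) (hP' : ∀ᵐ z ∂P', W (Prod.mk z ⁻¹' S) = h z * c)
    (hle : ∀ y, P ((fun z => (z, y)) ⁻¹' S) ≤ P' ((fun z => (z, y)) ⁻¹' S)) :
    ∫⁻ z, h z ∂P ≤ ∫⁻ z, h z ∂P' := by
  have hprod : ∫⁻ z, W (Prod.mk z ⁻¹' S) ∂P ≤ ∫⁻ z, W (Prod.mk z ⁻¹' S) ∂P' := by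
    rw [← Measure.prod_apply hS, ← Measure.prod_apply hS, Measure.prod_apply_symm hS,
      Measure.prod_apply_symm hS]
    exact lintegral_mono hle
  rwa [lintegral_congr_ae hP, lintegral_congr_ae hP', lintegral_mul_const' _ _ hc,
    lintegral_mul_const' _ _ hc, ENNReal.mul_le_mul_iff_left hc0 hc] at hprod

lemma setLIntegral_Ioi_eq_mul_comp_mul_left {x : ℝ} (hx : 0 < x) {g : ℝ → ℝ≥0∞}
    (hg : Measurable g) :
    ∫⁻ t in Ioi (0 : ℝ), g t = ENNReal.ofReal x * ∫⁻ t in Ioi (0 : ℝ), g (x * t) := by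
  have hpreimage : (x * ·) ⁻¹' Ioi (0 : ℝ) = Ioi 0 := by
    ext t
    simp [hx]
  conv_lhs => rw [← Real.smul_map_volume_mul_left hx.ne', abs_of_pos hx]
  rw [Measure.restrict_smul, lintegral_smul_measure,
    Measure.restrict_map (measurable_const_mul x) measurableSet_Ioi, hpreimage,
    lintegral_map hg (measurable_const_mul x), smul_eq_mul]

/-- The measure `t^(p-3) dt ⊗ ds` on `(0,∞) × ℝ`. It is translation invariant in `s` and
homogeneous of degree `p - 1`, so it turns families of planar sets indexed by intervals `(a, b)`
and equivariant under affine maps into the power `(b - a)^(p-1)`. -/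
noncomputable def layerMeasure (p : ℝ) : Measure (ℝ × ℝ) :=
  ((volume.restrict (Ioi (0 : ℝ))).withDensity fun t => ENNReal.ofReal (t ^ (p - 3))).prod volume

instance (p : ℝ) : SFinite (layerMeasure p) := by unfold layerMeasure; infer_instance

variable {p : ℝ} {T : Set (ℝ × ℝ)}

lemma layerMeasure_apply (p : ℝ) (hT : MeasurableSet T) :
    layerMeasure p T =
      ∫⁻ t in Ioi 0, ENNReal.ofReal (t ^ (p - 3)) * volume (Prod.mk t ⁻¹' T) := by
  rw [layerMeasure, Measure.prod_apply hT,
    lintegral_withDensity_eq_lintegral_mul _ (by fun_prop) (measurable_measure_prodMk_left hT)]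
  rfl

lemma volume_eq_mul_preimage_affine {x : ℝ} (hx : 0 < x) (a : ℝ) (A : Set ℝ) :
    volume A = ENNReal.ofReal x * volume ((fun s => a + x * s) ⁻¹' A) := by
  change volume A = ENNReal.ofReal x * volume ((x * ·) ⁻¹' ((a + ·) ⁻¹' A))
  rw [Real.volume_preimage_mul_left hx.ne', measure_preimage_add, abs_of_pos (inv_pos.2 hx),
    ← mul_assoc, ← ENNReal.ofReal_mul hx.le, mul_inv_cancel₀ hx.ne', ENNReal.ofReal_one, one_mul]

lemma layerMeasure_eq_rpow_mul_preimage_affine (p : ℝ) (hT : MeasurableSet T) (a : ℝ) {x : ℝ}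
    (hx : 0 < x) :
    layerMeasure p T = ENNReal.ofReal (x ^ (p - 1)) *
      layerMeasure p ((fun w => (x * w.1, a + x * w.2)) ⁻¹' T) := by
  have hsection (t : ℝ) : volume (Prod.mk (x * t) ⁻¹' T) = ENNReal.ofReal x *
      volume (Prod.mk t ⁻¹' ((fun w : ℝ × ℝ => (x * w.1, a + x * w.2)) ⁻¹' T)) :=
    volume_eq_mul_preimage_affine hx a _
  have hpow : x ^ (p - 1) = x * (x ^ (p - 3) * x) := by
    rw [← Real.rpow_add_one hx.ne', mul_comm, ← Real.rpow_add_one hx.ne']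
    ring_nf
  rw [layerMeasure_apply p hT, layerMeasure_apply p (hT.preimage (by fun_prop)),
    setLIntegral_Ioi_eq_mul_comp_mul_left hx
      (by have := measurable_measure_prodMk_left (ν := volume) hT; fun_prop),
    ← lintegral_const_mul' _ _ ENNReal.ofReal_ne_top,
    ← lintegral_const_mul' _ _ ENNReal.ofReal_ne_top]
  refine setLIntegral_congr_fun measurableSet_Ioi fun t (ht : 0 < t) => ?_
  rw [hsection, Real.mul_rpow hx.le ht.le, hpow, ENNReal.ofReal_mul (by positivity),
    ENNReal.ofReal_mul (by positivity), ENNReal.ofReal_mul (by positivity)]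
  ring

lemma layerMeasure_ne_zero {a b c d : ℝ} (ha : 0 ≤ a) (hab : a < b) (hcd : c < d)
    (hT : Ioo a b ×ˢ Ioo c d ⊆ T) : layerMeasure p T ≠ 0 := by
  refine fun h => (measure_mono_null hT h).not_gt ?_
  have hpos : Ioo a b ⊆ Ioi 0 := fun t ht => ha.trans_lt ht.1
  rw [layerMeasure, Measure.prod_prod, withDensity_apply _ measurableSet_Ioo,
    Measure.restrict_restrict_of_subset hpos, Real.volume_Ioo]
  refine ENNReal.mul_pos ?_ (by simpa using hcd)
  refine ((setLIntegral_pos_iff (by fun_prop)).2 ?_).ne'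
  refine lt_of_lt_of_le (by simpa using hab) (measure_mono (μ := volume) (s := Ioo a b) ?_)
  exact fun t ht => ⟨by simpa using Real.rpow_pos_of_pos (hpos ht) _, ht⟩

lemma layerMeasure_ne_top (hT : MeasurableSet T) {e e' : ℝ} (he : 2 < p + e) (he' : p + e' < 2)
    (h₀ : ∀ t ∈ Ioc (0 : ℝ) 1, volume (Prod.mk t ⁻¹' T) ≤ ENNReal.ofReal (t ^ e))
    (h₁ : ∀ t ∈ Ioi (1 : ℝ), volume (Prod.mk t ⁻¹' T) ≤ ENNReal.ofReal (t ^ e')) :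
    layerMeasure p T ≠ ∞ := by
  have hbound {A : Set ℝ} {k : ℝ} (hA : MeasurableSet A) (hpos : ∀ t ∈ A, 0 < t)
      (hint : IntegrableOn (fun t : ℝ => t ^ (p - 3 + k)) A)
      (h : ∀ t ∈ A, volume (Prod.mk t ⁻¹' T) ≤ ENNReal.ofReal (t ^ k)) :
      ∫⁻ t in A, ENNReal.ofReal (t ^ (p - 3)) * volume (Prod.mk t ⁻¹' T) < ∞ := by
    refine (setLIntegral_mono' hA fun t ht => ?_).trans_lt hint.lintegral_lt_top
    rw [Real.rpow_add (hpos t ht), ENNReal.ofReal_mul (Real.rpow_nonneg (hpos t ht).le _)]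
    exact mul_le_mul_right (h t ht) _
  rw [layerMeasure_apply p hT, ← Ioc_union_Ioi_eq_Ioi zero_le_one,
    lintegral_union measurableSet_Ioi (Ioc_disjoint_Ioi le_rfl)]
  refine (ENNReal.add_lt_top.2 ⟨hbound measurableSet_Ioc (fun t ht => ht.1) ?_ h₀,
    hbound measurableSet_Ioi (fun t ht => one_pos.trans ht) ?_ h₁⟩).ne
  · exact (intervalIntegrable_iff_integrableOn_Ioc_of_le zero_le_one).1
      (intervalIntegral.intervalIntegrable_rpow' (by linarith))
  · exact integrableOn_Ioi_rpow_of_lt (by linarith) one_pos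

lemma lintegral_rpow_sub_le_of_layers {P P' : Measure (ℝ × ℝ)} [SFinite P] [SFinite P']
    (hP : ∀ᵐ z ∂P, z.1 < z.2) (hP' : ∀ᵐ z ∂P', z.1 < z.2)
    {S : Set ((ℝ × ℝ) × (ℝ × ℝ))} (hS : MeasurableSet S)
    (haffine : ∀ a b, a < b → ∀ t s,
      ((a, b), ((b - a) * t, a + (b - a) * s)) ∈ S ↔ ((0, 1), (t, s)) ∈ S)
    (h0 : layerMeasure p (Prod.mk (0, 1) ⁻¹' S) ≠ 0)
    (htop : layerMeasure p (Prod.mk (0, 1) ⁻¹' S) ≠ ∞)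
    (hle : ∀ y, P ((fun z => (z, y)) ⁻¹' S) ≤ P' ((fun z => (z, y)) ⁻¹' S)) :
    ∫⁻ z, ENNReal.ofReal ((z.2 - z.1) ^ (p - 1)) ∂P ≤
      ∫⁻ z, ENNReal.ofReal ((z.2 - z.1) ^ (p - 1)) ∂P' := by
  have hsection (z : ℝ × ℝ) (hz : z.1 < z.2) : layerMeasure p (Prod.mk z ⁻¹' S) =
      ENNReal.ofReal ((z.2 - z.1) ^ (p - 1)) * layerMeasure p (Prod.mk (0, 1) ⁻¹' S) := by
    rw [layerMeasure_eq_rpow_mul_preimage_affine p (measurable_prodMk_left hS) z.1 (sub_pos.2 hz)]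
    congr 2
    ext w
    exact haffine z.1 z.2 hz w.1 w.2
  exact lintegral_le_of_section_le hS h0 htop (hP.mono hsection) (hP'.mono hsection) hle

end LayerCake

section Concordance

/-- The concordance order between measures on the plane with the same marginals: `P` is dominated
by `P'` on lower-left quadrants. -/
structure ConcordanceLE (P P' : Measure (ℝ × ℝ)) : Prop where
  fst_eq : P.map Prod.fst = P'.map Prod.fst
  snd_eq : P.map Prod.snd = P'.map Prod.snd
  le : ∀ s r, P (Iic s ×ˢ Iic r) ≤ P' (Iic s ×ˢ Iic r)

variable {P P' : Measure (ℝ × ℝ)}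

lemma measure_fst_le_snd_gt [IsFiniteMeasure P] (s r : ℝ) :
    P {z | z.1 ≤ s ∧ r < z.2} = P (Prod.fst ⁻¹' Iic s) - P (Iic s ×ˢ Iic r) := by
  have hsub : Iic s ×ˢ Iic r ⊆ Prod.fst ⁻¹' Iic s := fun z hz => hz.1
  rw [← measure_sdiff hsub
    (measurableSet_Iic.prod measurableSet_Iic).nullMeasurableSet (measure_ne_top _ _)]
  congr 1
  ext z
  simp only [mem_ofPred_eq, mem_sdiff, mem_preimage, mem_Iic, mem_prod]
  grind

lemma measure_fst_gt_snd_le [IsFiniteMeasure P] (s r : ℝ) :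
    P {z | s < z.1 ∧ z.2 ≤ r} = P (Prod.snd ⁻¹' Iic r) - P (Iic s ×ˢ Iic r) := by
  have hsub : Iic s ×ˢ Iic r ⊆ Prod.snd ⁻¹' Iic r := fun z hz => hz.2
  rw [← measure_sdiff hsub
    (measurableSet_Iic.prod measurableSet_Iic).nullMeasurableSet (measure_ne_top _ _)]
  congr 1
  ext z
  simp only [mem_ofPred_eq, mem_sdiff, mem_preimage, mem_Iic, mem_prod]
  grind

lemma measure_Iic_prod_Iic_self (h : ∀ᵐ z ∂P, z.1 < z.2) (s : ℝ) :
    P (Iic s ×ˢ Iic s) = P (Prod.snd ⁻¹' Iic s) :=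
  measure_congr (h.mono fun _ hz => propext ⟨fun h => h.2, fun h => ⟨hz.le.trans h, h⟩⟩)

lemma measure_Iic_prod_Ioc [IsFiniteMeasure P] (h : ∀ᵐ z ∂P, z.1 < z.2) {s r : ℝ} (hsr : s ≤ r) :
    P (Iic s ×ˢ Ioc s r) = P (Iic s ×ˢ Iic r) - P (Prod.snd ⁻¹' Iic s) := by
  rw [← measure_Iic_prod_Iic_self h, ← measure_sdiff (prod_mono_right (Iic_subset_Iic.2 hsr))
    (measurableSet_Iic.prod measurableSet_Iic).nullMeasurableSet (measure_ne_top _ _),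
    prod_sdiff_prod, sdiff_self, empty_prod, union_empty, Iic_sdiff_Iic]

namespace ConcordanceLE

lemma preimage_fst_eq (H : ConcordanceLE P P') {s : Set ℝ} (hs : MeasurableSet s) :
    P (Prod.fst ⁻¹' s) = P' (Prod.fst ⁻¹' s) := by
  rw [← Measure.map_apply measurable_fst hs, H.fst_eq, Measure.map_apply measurable_fst hs]

lemma preimage_snd_eq (H : ConcordanceLE P P') {s : Set ℝ} (hs : MeasurableSet s) :
    P (Prod.snd ⁻¹' s) = P' (Prod.snd ⁻¹' s) := by
  rw [← Measure.map_apply measurable_snd hs, H.snd_eq, Measure.map_apply measurable_snd hs]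

lemma univ_eq (H : ConcordanceLE P P') : P univ = P' univ := by
  simpa using H.preimage_fst_eq MeasurableSet.univ

variable [IsFiniteMeasure P] [IsFiniteMeasure P'] {p : ℝ}

lemma lintegral_rpow_le_of_two_lt (H : ConcordanceLE P P') (hP : ∀ᵐ z ∂P, z.1 < z.2)
    (hP' : ∀ᵐ z ∂P', z.1 < z.2) (hp : 2 < p) :
    ∫⁻ z, ENNReal.ofReal ((z.2 - z.1) ^ (p - 1)) ∂P' ≤
      ∫⁻ z, ENNReal.ofReal ((z.2 - z.1) ^ (p - 1)) ∂P := by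
  -- `(b - a)^(p-1)` is a multiple of `∫ t^(p-3) (b - a - t)⁺ dt`.
  have hS : MeasurableSet ({w : (ℝ × ℝ) × (ℝ × ℝ) | w.1.1 ≤ w.2.2} ∩
      {w | w.2.1 + w.2.2 < w.1.2}) :=
    (measurableSet_le (by fun_prop) (by fun_prop)).inter
      (measurableSet_lt (by fun_prop) (by fun_prop))
  refine lintegral_rpow_sub_le_of_layers hP' hP hS ?_ ?_ ?_ fun y => ?_
  · intro a b hab t s
    simp only [mem_inter_iff, mem_ofPred_eq]
    constructor <;> rintro ⟨h, h'⟩ <;> constructor <;> nlinarith [sub_pos.2 hab]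
  · refine layerMeasure_ne_zero (a := 0) (b := 1 / 2) (c := 0) (d := 1 / 2) le_rfl (by norm_num)
      (by norm_num) fun w ⟨h, h'⟩ => ⟨h'.1.le, ?_⟩
    change w.1 + w.2 < 1
    linarith [h.2, h'.2]
  · refine layerMeasure_ne_top (e := 0) (e' := -p) (measurable_prodMk_left hS) (by linarith)
      (by linarith) (fun t ht => ?_) fun t (ht : 1 < t) => ?_
    · refine (measure_mono (t := Ico 0 1) ?_).trans (by simp)
      rintro s ⟨(hs : 0 ≤ s), (hts : t + s < 1)⟩
      exact ⟨hs, by linarith [ht.1]⟩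
    · refine (measure_mono_null (t := ∅) ?_ measure_empty).trans_le zero_le
      rintro s ⟨(hs : 0 ≤ s), (hts : t + s < 1)⟩
      linarith [ht]
  · change P' {z | z.1 ≤ y.2 ∧ y.1 + y.2 < z.2} ≤ P {z | z.1 ≤ y.2 ∧ y.1 + y.2 < z.2}
    rw [measure_fst_le_snd_gt, measure_fst_le_snd_gt, H.preimage_fst_eq measurableSet_Iic]
    exact tsub_le_tsub_left (H.le _ _) _

lemma lintegral_rpow_le_of_lt_one (H : ConcordanceLE P P') (hP : ∀ᵐ z ∂P, z.1 < z.2)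
    (hP' : ∀ᵐ z ∂P', z.1 < z.2) (hp : p < 1) :
    ∫⁻ z, ENNReal.ofReal ((z.2 - z.1) ^ (p - 1)) ∂P' ≤
      ∫⁻ z, ENNReal.ofReal ((z.2 - z.1) ^ (p - 1)) ∂P := by
  -- `(b - a)^(p-1)` is a multiple of `∫ t^(p-3) (t - (b - a))⁺ dt`.
  have hS : MeasurableSet ({w : (ℝ × ℝ) × (ℝ × ℝ) | w.2.2 < w.1.1} ∩
      {w | w.1.2 ≤ w.2.1 + w.2.2}) :=
    (measurableSet_lt (by fun_prop) (by fun_prop)).inter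
      (measurableSet_le (by fun_prop) (by fun_prop))
  refine lintegral_rpow_sub_le_of_layers hP' hP hS ?_ ?_ ?_ fun y => ?_
  · intro a b hab t s
    simp only [mem_inter_iff, mem_ofPred_eq]
    constructor <;> rintro ⟨h, h'⟩ <;> constructor <;> nlinarith [sub_pos.2 hab]
  · refine layerMeasure_ne_zero (a := 2) (b := 3) (c := -1) (d := 0) (by norm_num) (by norm_num)
      (by norm_num) fun w ⟨h, h'⟩ => ⟨h'.2, ?_⟩
    change 1 ≤ w.1 + w.2
    linarith [h.1, h'.1]
  · refine layerMeasure_ne_top (e := 3 - p) (e' := 1) (measurable_prodMk_left hS) (by linarith)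
      (by linarith) (fun t ht => ?_) fun t _ => ?_
    · refine (measure_mono_null (t := ∅) ?_ measure_empty).trans_le zero_le
      rintro s ⟨(hs : s < 0), (hts : 1 ≤ t + s)⟩
      linarith [ht.2]
    · refine (measure_mono (t := Ico (-t) 0) ?_).trans (by simp)
      rintro s ⟨(hs : s < 0), (hts : 1 ≤ t + s)⟩
      exact ⟨by linarith, hs⟩
  · change P' {z | y.2 < z.1 ∧ z.2 ≤ y.1 + y.2} ≤ P {z | y.2 < z.1 ∧ z.2 ≤ y.1 + y.2}
    rw [measure_fst_gt_snd_le, measure_fst_gt_snd_le, H.preimage_snd_eq measurableSet_Iic]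
    exact tsub_le_tsub_left (H.le _ _) _

lemma lintegral_rpow_le_of_mem_Ioo (H : ConcordanceLE P P') (hP : ∀ᵐ z ∂P, z.1 < z.2)
    (hP' : ∀ᵐ z ∂P', z.1 < z.2) (hp : p ∈ Ioo (1 : ℝ) 2) :
    ∫⁻ z, ENNReal.ofReal ((z.2 - z.1) ^ (p - 1)) ∂P ≤
      ∫⁻ z, ENNReal.ofReal ((z.2 - z.1) ^ (p - 1)) ∂P' := by
  obtain ⟨hp1, hp2⟩ := hp
  -- `(b - a)^(p-1)` is a multiple of `∫ t^(p-3) min t (b - a) dt`.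
  have hS : MeasurableSet ({w : (ℝ × ℝ) × (ℝ × ℝ) | w.1.1 ≤ w.2.2} ∩
      ({w | w.2.2 < w.1.2} ∩ {w | w.1.2 ≤ w.2.1 + w.2.2})) :=
    (measurableSet_le (by fun_prop) (by fun_prop)).inter
      ((measurableSet_lt (by fun_prop) (by fun_prop)).inter
        (measurableSet_le (by fun_prop) (by fun_prop)))
  refine lintegral_rpow_sub_le_of_layers hP hP' hS ?_ ?_ ?_ fun y => ?_
  · intro a b hab t s
    simp only [mem_inter_iff, mem_ofPred_eq]
    constructor <;> rintro ⟨h, h', h''⟩ <;> refine ⟨?_, ?_, ?_⟩ <;> nlinarith [sub_pos.2 hab]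
  · refine layerMeasure_ne_zero (a := 1) (b := 2) (c := 0) (d := 1) (by norm_num) (by norm_num)
      (by norm_num) fun w ⟨h, h'⟩ => ⟨h'.1.le, h'.2, ?_⟩
    change 1 ≤ w.1 + w.2
    linarith [h.1, h'.1]
  · refine layerMeasure_ne_top (e := 1) (e' := 0) (measurable_prodMk_left hS) (by linarith)
      (by linarith) (fun t _ => ?_) fun t _ => ?_
    · refine (measure_mono (t := Ico (1 - t) 1) ?_).trans (by simp)
      rintro s ⟨_, (hs : s < 1), (hts : 1 ≤ t + s)⟩
      exact ⟨by linarith, hs⟩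
    · exact (measure_mono (t := Ico 0 1) fun s hs => ⟨hs.1, hs.2.1⟩).trans (by simp)
  · change P (Iic y.2 ×ˢ Ioc y.2 (y.1 + y.2)) ≤ P' (Iic y.2 ×ˢ Ioc y.2 (y.1 + y.2))
    rcases le_or_gt y.2 (y.1 + y.2) with hy | hy
    · rw [measure_Iic_prod_Ioc hP hy, measure_Iic_prod_Ioc hP' hy,
        H.preimage_snd_eq measurableSet_Iic]
      exact tsub_le_tsub_right (H.le _ _) _
    · simp [Ioc_eq_empty_of_le hy.le]

lemma lintegral_ofReal_sub_eq (H : ConcordanceLE P P') (hP : ∀ᵐ z ∂P, z.1 < z.2)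
    (hP' : ∀ᵐ z ∂P', z.1 < z.2) :
    ∫⁻ z, ENNReal.ofReal (z.2 - z.1) ∂P = ∫⁻ z, ENNReal.ofReal (z.2 - z.1) ∂P' := by
  have hS : MeasurableSet ({w : (ℝ × ℝ) × ℝ | w.1.1 ≤ w.2} ∩ {w | w.2 < w.1.2}) :=
    (measurableSet_le (by fun_prop) (by fun_prop)).inter
      (measurableSet_lt (by fun_prop) (by fun_prop))
  have hlength (z : ℝ × ℝ) : volume (Ico z.1 z.2) = ENNReal.ofReal (z.2 - z.1) * 1 := by
    rw [Real.volume_Ico, mul_one]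
  have hcover (s : ℝ) : P {z | z.1 ≤ s ∧ s < z.2} = P' {z | z.1 ≤ s ∧ s < z.2} := by
    rw [measure_fst_le_snd_gt, measure_fst_le_snd_gt, measure_Iic_prod_Iic_self hP,
      measure_Iic_prod_Iic_self hP', H.preimage_fst_eq measurableSet_Iic,
      H.preimage_snd_eq measurableSet_Iic]
  exact le_antisymm
    (lintegral_le_of_section_le hS one_ne_zero ENNReal.one_ne_top (ae_of_all _ hlength)
      (ae_of_all _ hlength) fun s => (hcover s).le)
    (lintegral_le_of_section_le hS one_ne_zero ENNReal.one_ne_top (ae_of_all _ hlength)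
      (ae_of_all _ hlength) fun s => (hcover s).ge)

lemma lintegral_rpow_eq (H : ConcordanceLE P P') (hP : ∀ᵐ z ∂P, z.1 < z.2)
    (hP' : ∀ᵐ z ∂P', z.1 < z.2) (hp : p ∈ ({1, 2} : Set ℝ)) :
    ∫⁻ z, ENNReal.ofReal ((z.2 - z.1) ^ (p - 1)) ∂P =
      ∫⁻ z, ENNReal.ofReal ((z.2 - z.1) ^ (p - 1)) ∂P' := by
  rcases hp with rfl | rfl
  · simp [H.univ_eq]
  · rw [show (2 : ℝ) - 1 = 1 by norm_num]
    simpa only [Real.rpow_one] using H.lintegral_ofReal_sub_eq hP hP'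

lemma lintegral_rpow_anti (H : ConcordanceLE P P') (hP : ∀ᵐ z ∂P, z.1 < z.2)
    (hP' : ∀ᵐ z ∂P', z.1 < z.2) (hp : p ∈ Iic (1 : ℝ) ∪ Ici 2) :
    ∫⁻ z, ENNReal.ofReal ((z.2 - z.1) ^ (p - 1)) ∂P' ≤
      ∫⁻ z, ENNReal.ofReal ((z.2 - z.1) ^ (p - 1)) ∂P := by
  rcases hp with hp | hp
  · rcases (mem_Iic.1 hp).eq_or_lt with rfl | h
    · exact (H.lintegral_rpow_eq hP hP' (mem_insert _ _)).ge
    · exact H.lintegral_rpow_le_of_lt_one hP hP' h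
  · rcases (mem_Ici.1 hp).eq_or_lt with rfl | h
    · exact (H.lintegral_rpow_eq hP hP' (mem_insert_of_mem _ rfl)).ge
    · exact H.lintegral_rpow_le_of_two_lt hP hP' h

lemma lintegral_rpow_mono (H : ConcordanceLE P P') (hP : ∀ᵐ z ∂P, z.1 < z.2)
    (hP' : ∀ᵐ z ∂P', z.1 < z.2) (hp : p ∈ Icc (1 : ℝ) 2) :
    ∫⁻ z, ENNReal.ofReal ((z.2 - z.1) ^ (p - 1)) ∂P ≤
      ∫⁻ z, ENNReal.ofReal ((z.2 - z.1) ^ (p - 1)) ∂P' := by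
  rcases hp.1.eq_or_lt with rfl | h1
  · exact (H.lintegral_rpow_eq hP hP' (mem_insert _ _)).le
  rcases hp.2.eq_or_lt with rfl | h2
  · exact (H.lintegral_rpow_eq hP hP' (mem_insert_of_mem _ rfl)).le
  · exact H.lintegral_rpow_le_of_mem_Ioo hP hP' ⟨h1, h2⟩

end ConcordanceLE

lemma ConcordanceLE.map_quantile (H : ConcordanceLE P P') (hP : ∀ᵐ z ∂P, z ∈ Ioo 0 1 ×ˢ Ioo 0 1)
    (hP' : ∀ᵐ z ∂P', z ∈ Ioo 0 1 ×ˢ Ioo 0 1) (η η' : Measure ℝ) :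
    ConcordanceLE (P.map (Prod.map (quantile η) (quantile η')))
      (P'.map (Prod.map (quantile η) (quantile η'))) := by
  have hη := measurable_quantile η
  have hη' := measurable_quantile η'
  have hfst (M : Measure (ℝ × ℝ)) : (M.map (Prod.map (quantile η) (quantile η'))).map Prod.fst =
      (M.map Prod.fst).map (quantile η) := by
    rw [Measure.map_map measurable_fst (hη.prodMap hη'), Measure.map_map hη measurable_fst]
    rfl
  have hsnd (M : Measure (ℝ × ℝ)) : (M.map (Prod.map (quantile η) (quantile η'))).map Prod.snd =
      (M.map Prod.snd).map (quantile η') := by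
    rw [Measure.map_map measurable_snd (hη.prodMap hη'), Measure.map_map hη' measurable_snd]
    rfl
  have hquadrant {M : Measure (ℝ × ℝ)} (hM : ∀ᵐ z ∂M, z ∈ Ioo 0 1 ×ˢ Ioo 0 1) (s r : ℝ) :
      M.map (Prod.map (quantile η) (quantile η')) (Iic s ×ˢ Iic r) =
        M (Iic (cdf η s) ×ˢ Iic (cdf η' r)) := by
    rw [Measure.map_apply (hη.prodMap hη') (measurableSet_Iic.prod measurableSet_Iic)]
    exact measure_congr (hM.mono fun z hz =>
      propext (and_congr (quantile_le_iff η hz.1 s) (quantile_le_iff η' hz.2 r)))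
  refine ⟨by rw [hfst, hfst, H.fst_eq], by rw [hsnd, hsnd, H.snd_eq], fun s r => ?_⟩
  rw [hquadrant hP, hquadrant hP']
  exact H.le _ _

variable {m : Measure ℝ} {T : ℝ → ℝ} {s : Set ℝ}

/-- The graph attains the Fréchet–Hoeffding upper bound `min (m (Iic a)) (m (T ⁻¹' Iic b))`. -/
lemma concordanceLE_graph_of_monotoneOn (hfst : P.map Prod.fst = m)
    (hsnd : P.map Prod.snd = m.map T) (hT : Measurable T) (hs : ∀ᵐ u ∂m, u ∈ s)
    (hmono : MonotoneOn T s) :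
    ConcordanceLE P (m.map fun u => (u, T u)) := by
  refine ⟨hfst.trans ((Measure.fst_map_prodMk hT).trans Measure.map_id).symm,
    hsnd.trans (Measure.snd_map_prodMk measurable_id).symm, fun a b => ?_⟩
  rw [Measure.map_apply (by fun_prop) (measurableSet_Iic.prod measurableSet_Iic)]
  by_cases h : ∀ u ∈ s, u ≤ a → T u ≤ b
  · calc P (Iic a ×ˢ Iic b) ≤ P (Prod.fst ⁻¹' Iic a) := measure_mono fun z hz => hz.1
      _ = m (Iic a) := by rw [← hfst, Measure.map_apply measurable_fst measurableSet_Iic]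
      _ ≤ m ((fun u => (u, T u)) ⁻¹' Iic a ×ˢ Iic b) :=
        measure_mono_ae (hs.mono fun u hu hua => ⟨hua, h u hu hua⟩)
  · push Not at h
    obtain ⟨u₀, hu₀, hua, hub⟩ := h
    calc P (Iic a ×ˢ Iic b) ≤ P (Prod.snd ⁻¹' Iic b) := measure_mono fun z hz => hz.2
      _ = m (T ⁻¹' Iic b) := by
        rw [← Measure.map_apply hT measurableSet_Iic, ← hsnd,
          Measure.map_apply measurable_snd measurableSet_Iic]
      _ ≤ m ((fun u => (u, T u)) ⁻¹' Iic a ×ˢ Iic b) :=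
        measure_mono_ae (hs.mono fun u hu hTu =>
          ⟨(lt_of_not_ge fun h => ((hmono hu₀ hu h).trans hTu).not_gt hub).le.trans hua, hTu⟩)

/-- The graph attains the Fréchet–Hoeffding lower bound
`(m (Iic a) + m (T ⁻¹' Iic b) - m univ)⁺`. -/
lemma concordanceLE_graph_of_antitoneOn [IsFiniteMeasure m] (hfst : P.map Prod.fst = m)
    (hsnd : P.map Prod.snd = m.map T) (hT : Measurable T) (hs : ∀ᵐ u ∂m, u ∈ s)
    (hanti : AntitoneOn T s) : ConcordanceLE (m.map fun u => (u, T u)) P := by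
  have hg : Measurable fun u => (u, T u) := by fun_prop
  have hA (a : ℝ) : P (Prod.fst ⁻¹' Iic a) = m (Iic a) := by
    rw [← hfst, Measure.map_apply measurable_fst measurableSet_Iic]
  have hB (b : ℝ) : P (Prod.snd ⁻¹' Iic b) = m (T ⁻¹' Iic b) := by
    rw [← Measure.map_apply measurable_snd measurableSet_Iic, hsnd,
      Measure.map_apply hT measurableSet_Iic]
  have huniv : P univ = m univ := by
    rw [← hfst, Measure.map_apply measurable_fst MeasurableSet.univ, preimage_univ]
  refine ⟨((Measure.fst_map_prodMk hT).trans Measure.map_id).trans hfst.symm,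
    (Measure.snd_map_prodMk measurable_id).trans hsnd.symm, fun a b => ?_⟩
  rw [Measure.map_apply hg (measurableSet_Iic.prod measurableSet_Iic)]
  by_cases h : ∀ u ∈ s, u ≤ a → b < T u
  · exact (measure_mono_null_ae (hs.mono fun u hu h' => (h u hu h'.1).not_ge h'.2)
      measure_empty).trans_le zero_le
  · push Not at h
    obtain ⟨u₀, hu₀, hua, hub⟩ := h
    have hcover : m univ ≤ m (Iic a ∪ T ⁻¹' Iic b) :=
      measure_mono_ae (hs.mono fun u hu _ => (le_total u u₀).imp (fun h => h.trans hua)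
        fun h => (hanti hu₀ hu h).trans hub)
    refine (ENNReal.add_le_add_iff_left (measure_ne_top m univ)).1 ?_
    calc m univ + m (Iic a ∩ T ⁻¹' Iic b) ≤ m (Iic a ∪ T ⁻¹' Iic b) + m (Iic a ∩ T ⁻¹' Iic b) :=
          add_le_add_left hcover _
      _ = P (Prod.fst ⁻¹' Iic a ∪ Prod.snd ⁻¹' Iic b) + P (Iic a ×ˢ Iic b) := by
          rw [measure_union_add_inter _ (hT measurableSet_Iic), ← hA, ← hB,
            ← measure_union_add_inter _ (measurable_snd measurableSet_Iic)]
          rfl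
      _ ≤ m univ + P (Iic a ×ˢ Iic b) :=
          add_le_add_left ((measure_mono (subset_univ _)).trans_eq huniv) _

end Concordance

section Marginals

variable {μ ν : Measure ℝ}

lemma posDiff_nonneg (u : ℝ) : 0 ≤ posDiff μ ν u := le_max_right _ _

lemma negDiff_nonneg (u : ℝ) : 0 ≤ negDiff μ ν u := le_max_right _ _

lemma posDiff_pos_iff {u : ℝ} : 0 < posDiff μ ν u ↔ quantile ν u < quantile μ u := by
  simp [posDiff]

lemma negDiff_pos_iff {u : ℝ} : 0 < negDiff μ ν u ↔ quantile μ u < quantile ν u := by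
  simp [negDiff]

lemma posDiff_sub_negDiff (u : ℝ) :
    posDiff μ ν u - negDiff μ ν u = quantile μ u - quantile ν u :=
  max_zero_sub_max_neg_zero_eq_self _

lemma measurable_posDiff : Measurable (posDiff μ ν) :=
  ((measurable_quantile μ).sub (measurable_quantile ν)).max measurable_const

lemma measurable_negDiff : Measurable (negDiff μ ν) :=
  ((measurable_quantile μ).sub (measurable_quantile ν)).neg.max measurable_const

lemma marginalPlus_eq_scaledDensity :
    marginalPlus μ ν = scaledDensity (posDiff μ ν) (gam μ ν) := rfl

lemma marginalMinus_eq_scaledDensity :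
    marginalMinus μ ν = scaledDensity (negDiff μ ν) (gam μ ν) := rfl

instance : SFinite (marginalPlus μ ν) := inferInstanceAs (SFinite (scaledDensity _ _))

instance : SFinite (marginalMinus μ ν) := inferInstanceAs (SFinite (scaledDensity _ _))

instance : NullSingletonClass (marginalPlus μ ν) :=
  inferInstanceAs (NullSingletonClass (scaledDensity _ _))

lemma ae_marginalPlus_iff (hγ : 0 < gam μ ν) {p : ℝ → Prop} :
    (∀ᵐ u ∂marginalPlus μ ν, p u) ↔
      ∀ᵐ u ∂volume.restrict (Ioo (0 : ℝ) 1), quantile ν u < quantile μ u → p u := by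
  simp only [marginalPlus_eq_scaledDensity, ae_scaledDensity_iff measurable_posDiff hγ,
    posDiff_pos_iff]

lemma ae_marginalMinus_iff (hγ : 0 < gam μ ν) {p : ℝ → Prop} :
    (∀ᵐ u ∂marginalMinus μ ν, p u) ↔
      ∀ᵐ u ∂volume.restrict (Ioo (0 : ℝ) 1), quantile μ u < quantile ν u → p u := by
  simp only [marginalMinus_eq_scaledDensity, ae_scaledDensity_iff measurable_negDiff hγ,
    negDiff_pos_iff]

lemma measurableSet_unitSquare_lt :
    MeasurableSet {z : ℝ × ℝ | z.1 ∈ Ioo (0 : ℝ) 1 ∧ z.2 ∈ Ioo (0 : ℝ) 1 ∧ z.1 < z.2} :=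
  (measurable_fst measurableSet_Ioo).inter
    ((measurable_snd measurableSet_Ioo).inter (measurableSet_lt measurable_fst measurable_snd))

variable {Q : Measure (ℝ × ℝ)}

lemma ae_unitSquare_lt_of_mem_QSet (hQ : Q ∈ QSet μ ν) :
    ∀ᵐ z ∂Q, z.1 ∈ Ioo (0 : ℝ) 1 ∧ z.2 ∈ Ioo (0 : ℝ) 1 ∧ z.1 < z.2 :=
  have := hQ.1
  (prob_compl_eq_zero_iff measurableSet_unitSquare_lt).2 hQ.2.2.2

lemma ae_quantile_chain_of_mem_QSet (hγ : 0 < gam μ ν) (hQ : Q ∈ QSet μ ν) :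
    ∀ᵐ z ∂Q, quantile ν z.1 < quantile μ z.1 ∧ quantile μ z.1 ≤ quantile μ z.2 ∧
      quantile μ z.2 < quantile ν z.2 := by
  have hplus : ∀ᵐ u ∂Q.map Prod.fst, quantile ν u < quantile μ u := by
    rw [hQ.2.1, ae_marginalPlus_iff hγ]
    exact ae_of_all _ fun _ => id
  have hminus : ∀ᵐ u ∂Q.map Prod.snd, quantile μ u < quantile ν u := by
    rw [hQ.2.2.1, ae_marginalMinus_iff hγ]
    exact ae_of_all _ fun _ => id
  filter_upwards [ae_unitSquare_lt_of_mem_QSet hQ, ae_of_ae_map measurable_fst.aemeasurable hplus,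
    ae_of_ae_map measurable_snd.aemeasurable hminus] with z ⟨h1, h2, hlt⟩ hz1 hz2
  exact ⟨hz1, quantile_monotoneOn μ h1 h2 hlt.le, hz2⟩

lemma graph_mem_QSet [IsProbabilityMeasure (marginalPlus μ ν)] {T : ℝ → ℝ} (hT : Measurable T)
    (hmap : (marginalPlus μ ν).map T = marginalMinus μ ν)
    (hlt : ∀ᵐ u ∂marginalPlus μ ν, u < T u) :
    (marginalPlus μ ν).map (fun u => (u, T u)) ∈ QSet μ ν := by
  have hg : Measurable fun u => (u, T u) := by fun_prop
  have hprob := Measure.isProbabilityMeasure_map (μ := marginalPlus μ ν) hg.aemeasurable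
  have hmem : ∀ᵐ u ∂marginalPlus μ ν, u ∈ Ioo (0 : ℝ) 1 := ae_mem_Ioo_scaledDensity
  have hTmem : ∀ᵐ u ∂marginalPlus μ ν, T u ∈ Ioo (0 : ℝ) 1 :=
    ae_of_ae_map hT.aemeasurable (hmap ▸ ae_mem_Ioo_scaledDensity)
  refine ⟨hprob, (Measure.fst_map_prodMk hT).trans Measure.map_id,
    (Measure.snd_map_prodMk measurable_id).trans hmap, ?_⟩
  refine (prob_compl_eq_zero_iff measurableSet_unitSquare_lt).1
    ((ae_map_iff hg.aemeasurable measurableSet_unitSquare_lt).2 ?_)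
  filter_upwards [hmem, hTmem, hlt] with u h1 h2 h3
  exact ⟨h1, h2, h3⟩

end Marginals

section Cost

variable {μ ν : Measure ℝ} {u ρ : ℝ}

/-- The integrand `|F_ν⁻¹(u) - y|^ρ 1_{y ≠ F_ν⁻¹(u)}` of `cost`. -/
noncomputable def jumpCost (ν : Measure ℝ) (ρ u : ℝ) : ℝ → ℝ≥0∞ :=
  ({y | y ≠ quantile ν u} : Set ℝ).indicator fun y => ENNReal.ofReal (|quantile ν u - y| ^ ρ)

lemma measurable_jumpCost : Measurable (jumpCost ν ρ u) :=
  Measurable.indicator (by fun_prop) (measurableSet_singleton _).compl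

lemma jumpCost_self : jumpCost ν ρ u (quantile ν u) = 0 := indicator_of_notMem (by simp) _

lemma jumpCost_of_ne {y : ℝ} (hy : y ≠ quantile ν u) :
    jumpCost ν ρ u y = ENNReal.ofReal (|y - quantile ν u| ^ ρ) := by
  rw [jumpCost, indicator_of_mem hy, abs_sub_comm]

lemma lintegral_jumpCost_splitMeasure {π : Measure ℝ} (h : ∀ᵐ v ∂π, v ∈ Ioo (0 : ℝ) 1 ∧
      0 < (quantile μ u - quantile ν u) / (quantile ν v - quantile ν u)) :
    ∫⁻ y, jumpCost ν ρ u y ∂splitMeasure μ ν π u =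
      ENNReal.ofReal |quantile μ u - quantile ν u| *
        ∫⁻ v, ENNReal.ofReal (|quantile ν v - quantile ν u| ^ (ρ - 1)) ∂π := by
  have hν := measurable_quantile ν
  have hcomp : Measurable fun v => jumpCost ν ρ u (quantile ν v) := measurable_jumpCost.comp hν
  have hsupport : π.restrict (Ioo 0 1) = π :=
    Measure.restrict_eq_self_of_ae_mem (h.mono fun v hv => hv.1)
  rw [splitMeasure, lintegral_add_measure, hsupport, lintegral_map measurable_jumpCost hν,
    lintegral_smul_measure, lintegral_dirac' _ measurable_jumpCost, jumpCost_self, smul_zero,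
    add_zero, lintegral_withDensity_eq_lintegral_mul _ (by fun_prop) hcomp,
    ← lintegral_const_mul' _ _ ENNReal.ofReal_ne_top]
  refine lintegral_congr_ae (h.mono fun v ⟨_, hv⟩ => ?_)
  have hne : quantile ν v - quantile ν u ≠ 0 := fun h0 => by simp [h0] at hv
  simp only [Pi.mul_apply]
  rw [jumpCost_of_ne (sub_ne_zero.1 hne), ← ENNReal.ofReal_mul hv.le,
    ← ENNReal.ofReal_mul (abs_nonneg _), ← abs_of_pos hv, abs_div,
    Real.rpow_sub_one (abs_pos.2 hne).ne']
  ring_nf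

variable {Q : Measure (ℝ × ℝ)}

lemma tildeKernel_of_mem_regionPlus (D : Disintegration μ ν Q) (h : u ∈ regionPlus μ ν D.piPlus) :
    tildeKernel D u = splitMeasure μ ν (D.piPlus u) u := by
  classical exact if_pos h

lemma tildeKernel_of_mem_regionMinus (D : Disintegration μ ν Q)
    (h : u ∈ regionMinus μ ν D.piMinus) :
    tildeKernel D u = splitMeasure μ ν (D.piMinus u) u := by
  classical exact (if_neg fun h' => h'.2.1.not_gt h.2.1).trans (if_pos h)

lemma tildeKernel_of_quantile_eq (D : Disintegration μ ν Q) (h : quantile μ u = quantile ν u) :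
    tildeKernel D u = Measure.dirac (quantile ν u) := by
  classical exact (if_neg fun h' => h'.2.1.ne' h).trans (if_neg fun h' => h'.2.1.ne h)

lemma ae_piPlus (hγ : 0 < gam μ ν) (hQ : Q ∈ QSet μ ν) (D : Disintegration μ ν Q) :
    ∀ᵐ u ∂volume.restrict (Ioo (0 : ℝ) 1), quantile ν u < quantile μ u →
      ∀ᵐ v ∂D.piPlus u, v ∈ Ioo (0 : ℝ) 1 ∧ quantile μ u < quantile ν v := by
  have hae : ∀ᵐ z ∂Q, z.2 ∈ Ioo (0 : ℝ) 1 ∧ quantile μ z.1 < quantile ν z.2 := by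
    filter_upwards [ae_unitSquare_lt_of_mem_QSet hQ, ae_quantile_chain_of_mem_QSet hγ hQ]
      with z hz ⟨_, hle, hlt⟩
    exact ⟨hz.2.1, hle.trans_lt hlt⟩
  rw [D.eq_plus] at hae
  exact (ae_marginalPlus_iff hγ).1 (Measure.ae_ae_of_ae_compProd hae)

lemma ae_piMinus (hγ : 0 < gam μ ν) (hQ : Q ∈ QSet μ ν) (D : Disintegration μ ν Q) :
    ∀ᵐ u ∂volume.restrict (Ioo (0 : ℝ) 1), quantile μ u < quantile ν u →
      ∀ᵐ v ∂D.piMinus u, v ∈ Ioo (0 : ℝ) 1 ∧ quantile ν v < quantile μ u := by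
  have hae : ∀ᵐ z ∂Q, z.1 ∈ Ioo (0 : ℝ) 1 ∧ quantile ν z.1 < quantile μ z.2 := by
    filter_upwards [ae_unitSquare_lt_of_mem_QSet hQ, ae_quantile_chain_of_mem_QSet hγ hQ]
      with z hz ⟨hlt, hle, _⟩
    exact ⟨hz.1, hlt.trans_le hle⟩
  rw [D.eq_minus] at hae
  exact (ae_marginalMinus_iff hγ).1
    (Measure.ae_ae_of_ae_compProd (ae_of_ae_map measurable_swap.aemeasurable hae))

lemma ae_lintegral_jumpCost_of_lt (hγ : 0 < gam μ ν) (hQ : Q ∈ QSet μ ν)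
    (D : Disintegration μ ν Q) :
    ∀ᵐ u ∂volume.restrict (Ioo (0 : ℝ) 1), quantile ν u < quantile μ u →
      ∫⁻ y, jumpCost ν ρ u y ∂tildeKernel D u = ENNReal.ofReal |quantile μ u - quantile ν u| *
        ∫⁻ v, ENNReal.ofReal (|quantile ν v - quantile ν u| ^ (ρ - 1)) ∂D.piPlus u := by
  filter_upwards [ae_piPlus hγ hQ D, D.piPlus_mass, ae_restrict_mem measurableSet_Ioo]
    with u hae hmass hu h
  have hregion : u ∈ regionPlus μ ν D.piPlus := by
    refine ⟨hu, h, (measure_congr ?_).trans (hmass h)⟩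
    exact (hae h).mono fun v hv => propext ⟨And.left, fun _ => hv⟩
  rw [tildeKernel_of_mem_regionPlus D hregion, lintegral_jumpCost_splitMeasure]
  exact (hae h).mono fun v hv => ⟨hv.1, div_pos (sub_pos.2 h) (sub_pos.2 (h.trans hv.2))⟩

lemma ae_lintegral_jumpCost_of_gt (hγ : 0 < gam μ ν) (hQ : Q ∈ QSet μ ν)
    (D : Disintegration μ ν Q) :
    ∀ᵐ u ∂volume.restrict (Ioo (0 : ℝ) 1), quantile μ u < quantile ν u →
      ∫⁻ y, jumpCost ν ρ u y ∂tildeKernel D u = ENNReal.ofReal |quantile μ u - quantile ν u| *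
        ∫⁻ v, ENNReal.ofReal (|quantile ν v - quantile ν u| ^ (ρ - 1)) ∂D.piMinus u := by
  filter_upwards [ae_piMinus hγ hQ D, D.piMinus_mass, ae_restrict_mem measurableSet_Ioo]
    with u hae hmass hu h
  have hregion : u ∈ regionMinus μ ν D.piMinus := by
    refine ⟨hu, h, (measure_congr ?_).trans (hmass h)⟩
    exact (hae h).mono fun v hv => propext ⟨And.left, fun _ => hv⟩
  rw [tildeKernel_of_mem_regionMinus D hregion, lintegral_jumpCost_splitMeasure]
  exact (hae h).mono fun v hv =>
    ⟨hv.1, div_pos_of_neg_of_neg (sub_neg.2 h) (sub_neg.2 (hv.2.trans h))⟩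

lemma ae_lintegral_jumpCost_tildeKernel (hγ : 0 < gam μ ν) (hQ : Q ∈ QSet μ ν)
    (D : Disintegration μ ν Q) (ρ : ℝ) :
    ∀ᵐ u ∂volume.restrict (Ioo (0 : ℝ) 1), ∫⁻ y, jumpCost ν ρ u y ∂tildeKernel D u =
      ENNReal.ofReal (posDiff μ ν u) *
          ∫⁻ v, ENNReal.ofReal (|quantile ν v - quantile ν u| ^ (ρ - 1)) ∂D.piPlus u +
        ENNReal.ofReal (negDiff μ ν u) *
          ∫⁻ v, ENNReal.ofReal (|quantile ν v - quantile ν u| ^ (ρ - 1)) ∂D.piMinus u := by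
  filter_upwards [ae_lintegral_jumpCost_of_lt hγ hQ D, ae_lintegral_jumpCost_of_gt hγ hQ D]
    with u hplus hminus
  rcases lt_trichotomy (quantile ν u) (quantile μ u) with h | h | h
  · rw [hplus h, abs_of_pos (sub_pos.2 h), posDiff, negDiff, max_eq_left (sub_nonneg.2 h.le),
      max_eq_right (neg_nonpos.2 (sub_nonneg.2 h.le)), ENNReal.ofReal_zero, zero_mul, add_zero]
  · rw [tildeKernel_of_quantile_eq D h.symm, lintegral_dirac' _ measurable_jumpCost, jumpCost_self]
    simp [posDiff, negDiff, h]
  · rw [hminus h, abs_of_neg (sub_neg.2 h), posDiff, negDiff, max_eq_right (sub_nonpos.2 h.le),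
      max_eq_left (neg_nonneg.2 (sub_nonpos.2 h.le)), ENNReal.ofReal_zero, zero_mul, zero_add]

lemma cost_tildeKernel (hγ : 0 < gam μ ν) (hQ : Q ∈ QSet μ ν) (D : Disintegration μ ν Q)
    (ρ : ℝ) :
    cost ν ρ (tildeKernel D) = 2 * ENNReal.ofReal (gam μ ν) *
      ∫⁻ z, ENNReal.ofReal ((quantile ν z.2 - quantile ν z.1) ^ (ρ - 1)) ∂Q := by
  set K : ℝ × ℝ → ℝ≥0∞ := fun z => ENNReal.ofReal (|quantile ν z.2 - quantile ν z.1| ^ (ρ - 1))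
    with hK
  have hKm : Measurable K := by have := measurable_quantile ν; fun_prop
  have hKpos : ∫⁻ z, ENNReal.ofReal ((quantile ν z.2 - quantile ν z.1) ^ (ρ - 1)) ∂Q =
      ∫⁻ z, K z ∂Q := by
    refine lintegral_congr_ae ((ae_quantile_chain_of_mem_QSet hγ hQ).mono fun z hz => ?_)
    simp only [hK, abs_of_pos (sub_pos.2 (hz.1.trans (hz.2.1.trans_lt hz.2.2)))]
  have hKswap (z : ℝ × ℝ) : K z.swap = K z := by simp only [hK, Prod.swap, abs_sub_comm]
  have hplus : ∫⁻ u in Ioo (0 : ℝ) 1,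
      ENNReal.ofReal (posDiff μ ν u) * ∫⁻ v, K (u, v) ∂D.piPlus u =
      ENNReal.ofReal (gam μ ν) * ∫⁻ z, K z ∂Q := by
    rw [setLIntegral_mul_lintegral_kernel measurable_posDiff hγ D.piPlus hKm,
      ← marginalPlus_eq_scaledDensity, ← D.eq_plus]
  have hminus : ∫⁻ u in Ioo (0 : ℝ) 1,
      ENNReal.ofReal (negDiff μ ν u) * ∫⁻ v, K (u, v) ∂D.piMinus u =
      ENNReal.ofReal (gam μ ν) * ∫⁻ z, K z ∂Q := by
    rw [setLIntegral_mul_lintegral_kernel measurable_negDiff hγ D.piMinus hKm,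
      ← marginalMinus_eq_scaledDensity]
    conv_rhs => rw [D.eq_minus, lintegral_map hKm measurable_swap]
    simp only [hKswap]
  have hmeas : Measurable fun u => ENNReal.ofReal (posDiff μ ν u) * ∫⁻ v, K (u, v) ∂D.piPlus u :=
    measurable_posDiff.ennreal_ofReal.mul hKm.lintegral_kernel_prod_right'
  calc cost ν ρ (tildeKernel D)
      = ∫⁻ u in Ioo (0 : ℝ) 1, (ENNReal.ofReal (posDiff μ ν u) * ∫⁻ v, K (u, v) ∂D.piPlus u +
          ENNReal.ofReal (negDiff μ ν u) * ∫⁻ v, K (u, v) ∂D.piMinus u) :=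
        lintegral_congr_ae (ae_lintegral_jumpCost_tildeKernel hγ hQ D ρ)
    _ = 2 * ENNReal.ofReal (gam μ ν) * ∫⁻ z, K z ∂Q := by
        rw [lintegral_add_left hmeas, hplus, hminus, ← two_mul, mul_assoc]
    _ = _ := by rw [hKpos]

lemma cost_comparison (hγ : 0 < gam μ ν) {Q' : Measure (ℝ × ℝ)} (hQ : Q ∈ QSet μ ν)
    (hQ' : Q' ∈ QSet μ ν) (h : ConcordanceLE Q Q') (D : Disintegration μ ν Q)
    (D' : Disintegration μ ν Q') :
    (∀ ρ ∈ Iic (1 : ℝ) ∪ Ici 2, cost ν ρ (tildeKernel D') ≤ cost ν ρ (tildeKernel D)) ∧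
    (∀ ρ ∈ Icc (1 : ℝ) 2, cost ν ρ (tildeKernel D) ≤ cost ν ρ (tildeKernel D')) ∧
    (∀ ρ ∈ ({1, 2} : Set ℝ), cost ν ρ (tildeKernel D') = cost ν ρ (tildeKernel D)) := by
  have hm : Measurable (Prod.map (quantile ν) (quantile ν)) :=
    (measurable_quantile ν).prodMap (measurable_quantile ν)
  have hprob := hQ.1
  have hprob' := hQ'.1
  have hcost {M : Measure (ℝ × ℝ)} (hM : M ∈ QSet μ ν) (E : Disintegration μ ν M) (ρ : ℝ) :
      cost ν ρ (tildeKernel E) = 2 * ENNReal.ofReal (gam μ ν) *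
        ∫⁻ z, ENNReal.ofReal ((z.2 - z.1) ^ (ρ - 1))
          ∂M.map (Prod.map (quantile ν) (quantile ν)) := by
    rw [cost_tildeKernel hγ hM E ρ, lintegral_map (by fun_prop) hm]
    rfl
  have hsquare {M : Measure (ℝ × ℝ)} (hM : M ∈ QSet μ ν) :
      ∀ᵐ z ∂M, z ∈ Ioo (0 : ℝ) 1 ×ˢ Ioo (0 : ℝ) 1 :=
    (ae_unitSquare_lt_of_mem_QSet hM).mono fun z hz => ⟨hz.1, hz.2.1⟩
  have hlt {M : Measure (ℝ × ℝ)} (hM : M ∈ QSet μ ν) :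
      ∀ᵐ z ∂M.map (Prod.map (quantile ν) (quantile ν)), z.1 < z.2 :=
    (ae_map_iff hm.aemeasurable (measurableSet_lt measurable_fst measurable_snd)).2
      ((ae_quantile_chain_of_mem_QSet hγ hM).mono fun z hz => hz.1.trans (hz.2.1.trans_lt hz.2.2))
  have H := h.map_quantile (hsquare hQ) (hsquare hQ') ν ν
  simp only [hcost hQ, hcost hQ']
  exact ⟨fun ρ hρ => mul_le_mul_right (H.lintegral_rpow_anti (hlt hQ) (hlt hQ') hρ) _,
    fun ρ hρ => mul_le_mul_right (H.lintegral_rpow_mono (hlt hQ) (hlt hQ') hρ) _,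
    fun ρ hρ => by rw [H.lintegral_rpow_eq (hlt hQ) (hlt hQ') hρ]⟩

end Cost

section Order

variable {μ ν : Measure ℝ} [IsProbabilityMeasure μ] [IsProbabilityMeasure ν]

lemma intervalIntegrable_diff (hμ : Integrable (fun x : ℝ => x) μ)
    (hν : Integrable (fun x : ℝ => x) ν) :
    IntervalIntegrable (fun u => quantile μ u - quantile ν u) volume 0 1 :=
  (intervalIntegrable_quantile hμ).sub (intervalIntegrable_quantile hν)

lemma intervalIntegrable_posDiff (hμ : Integrable (fun x : ℝ => x) μ)
    (hν : Integrable (fun x : ℝ => x) ν) : IntervalIntegrable (posDiff μ ν) volume 0 1 :=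
  ⟨(intervalIntegrable_diff hμ hν).1.pos_part, (intervalIntegrable_diff hμ hν).2.pos_part⟩

lemma intervalIntegrable_negDiff (hμ : Integrable (fun x : ℝ => x) μ)
    (hν : Integrable (fun x : ℝ => x) ν) : IntervalIntegrable (negDiff μ ν) volume 0 1 :=
  ⟨(intervalIntegrable_diff hμ hν).1.neg_part, (intervalIntegrable_diff hμ hν).2.neg_part⟩

lemma PsiPlus_sub_PsiMinus (hμ : Integrable (fun x : ℝ => x) μ)
    (hν : Integrable (fun x : ℝ => x) ν) {u : ℝ} (hu : u ∈ Icc (0 : ℝ) 1) :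
    PsiPlus μ ν u - PsiMinus μ ν u = ∫ v in (0 : ℝ)..u, (quantile μ v - quantile ν v) := by
  have hsub : uIcc 0 u ⊆ uIcc (0 : ℝ) 1 := uIcc_subset_uIcc left_mem_uIcc (Icc_subset_uIcc hu)
  rw [PsiPlus, PsiMinus, ← intervalIntegral.integral_sub
    ((intervalIntegrable_posDiff hμ hν).mono_set hsub)
    ((intervalIntegrable_negDiff hμ hν).mono_set hsub)]
  simp only [posDiff_sub_negDiff]

namespace StrictConvexOrder

lemma integral_diff_nonneg (hcx : StrictConvexOrder μ ν) (hμ : Integrable (fun x : ℝ => x) μ)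
    (hν : Integrable (fun x : ℝ => x) ν) {u : ℝ} (hu : u ∈ Icc (0 : ℝ) 1) :
    0 ≤ ∫ v in (0 : ℝ)..u, (quantile μ v - quantile ν v) := by
  have hsub : uIcc 0 u ⊆ uIcc (0 : ℝ) 1 := uIcc_subset_uIcc left_mem_uIcc (Icc_subset_uIcc hu)
  rw [intervalIntegral.integral_sub ((intervalIntegrable_quantile hμ).mono_set hsub)
    ((intervalIntegrable_quantile hν).mono_set hsub)]
  exact sub_nonneg.2 (hcx.integral_quantile_le hμ hν hu)

lemma PsiMinus_one (hcx : StrictConvexOrder μ ν) (hμ : Integrable (fun x : ℝ => x) μ)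
    (hν : Integrable (fun x : ℝ => x) ν) : PsiMinus μ ν 1 = gam μ ν := by
  have h := PsiPlus_sub_PsiMinus hμ hν (right_mem_Icc.2 zero_le_one)
  rw [intervalIntegral.integral_sub (intervalIntegrable_quantile hμ)
    (intervalIntegrable_quantile hν), hcx.integral_quantile_eq hν, sub_self, sub_eq_zero] at h
  exact h.symm

lemma gam_pos (hcx : StrictConvexOrder μ ν) (hμ : Integrable (fun x : ℝ => x) μ)
    (hν : Integrable (fun x : ℝ => x) ν) : 0 < gam μ ν := by
  refine lt_of_le_of_ne
    (intervalIntegral.integral_nonneg zero_le_one fun u _ => posDiff_nonneg u) fun h0 => hcx.2 ?_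
  have hpos : posDiff μ ν =ᵐ[volume.restrict (Ioc 0 1)] 0 :=
    (intervalIntegral.integral_eq_zero_iff_of_le_of_nonneg_ae zero_le_one
      (ae_of_all _ posDiff_nonneg) (intervalIntegrable_posDiff hμ hν)).1 h0.symm
  have hneg : negDiff μ ν =ᵐ[volume.restrict (Ioc 0 1)] 0 :=
    (intervalIntegral.integral_eq_zero_iff_of_le_of_nonneg_ae zero_le_one
      (ae_of_all _ negDiff_nonneg) (intervalIntegrable_negDiff hμ hν)).1
      ((hcx.PsiMinus_one hμ hν).trans h0.symm)
  rw [← map_quantile μ, ← map_quantile ν, restrict_Ioo_eq_restrict_Ioc]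
  refine Measure.map_congr ?_
  filter_upwards [hpos, hneg] with u hu hu'
  rw [← sub_eq_zero, ← posDiff_sub_negDiff, hu, hu', sub_self]

/-- A nonnegative primitive has no zero where its derivative is positive, since a zero would be a
minimum. -/
lemma ae_integral_diff_pos (hcx : StrictConvexOrder μ ν) (hμ : Integrable (fun x : ℝ => x) μ)
    (hν : Integrable (fun x : ℝ => x) ν) :
    ∀ᵐ u ∂marginalPlus μ ν, 0 < ∫ v in (0 : ℝ)..u, (quantile μ v - quantile ν v) := by
  rw [ae_marginalPlus_iff (hcx.gam_pos hμ hν)]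
  filter_upwards [ae_restrict_of_ae (intervalIntegrable_diff hμ hν).ae_hasDerivAt_integral,
    ae_restrict_mem measurableSet_Ioo] with u hder hu hlt
  have hu' := Ioo_subset_Icc_self hu
  refine lt_of_le_of_ne (hcx.integral_diff_nonneg hμ hν hu') fun h0 => ?_
  have hmin : IsLocalMin (fun x => ∫ v in (0 : ℝ)..x, (quantile μ v - quantile ν v)) u := by
    filter_upwards [Icc_mem_nhds hu.1 hu.2] with x hx
    rw [← h0]
    exact hcx.integral_diff_nonneg hμ hν hx
  exact (sub_pos.2 hlt).ne'
    (hmin.hasDerivAt_eq_zero (hder (Icc_subset_uIcc hu') 0 left_mem_uIcc))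

lemma isProbabilityMeasure_marginalPlus (hcx : StrictConvexOrder μ ν)
    (hμ : Integrable (fun x : ℝ => x) μ) (hν : Integrable (fun x : ℝ => x) ν) :
    IsProbabilityMeasure (marginalPlus μ ν) :=
  isProbabilityMeasure_scaledDensity posDiff_nonneg (hcx.gam_pos hμ hν) rfl

lemma isProbabilityMeasure_marginalMinus (hcx : StrictConvexOrder μ ν)
    (hμ : Integrable (fun x : ℝ => x) μ) (hν : Integrable (fun x : ℝ => x) ν) :
    IsProbabilityMeasure (marginalMinus μ ν) :=
  isProbabilityMeasure_scaledDensity negDiff_nonneg (hcx.gam_pos hμ hν) (hcx.PsiMinus_one hμ hν)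

lemma cdf_marginalPlus (hcx : StrictConvexOrder μ ν) (hμ : Integrable (fun x : ℝ => x) μ)
    (hν : Integrable (fun x : ℝ => x) ν) {u : ℝ} (hu : u ∈ Icc (0 : ℝ) 1) :
    cdf (marginalPlus μ ν) u = PsiPlus μ ν u / gam μ ν :=
  have : IsProbabilityMeasure (scaledDensity (posDiff μ ν) (gam μ ν)) :=
    hcx.isProbabilityMeasure_marginalPlus hμ hν
  cdf_scaledDensity posDiff_nonneg (intervalIntegrable_posDiff hμ hν) (hcx.gam_pos hμ hν).le hu

lemma cdf_marginalMinus (hcx : StrictConvexOrder μ ν) (hμ : Integrable (fun x : ℝ => x) μ)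
    (hν : Integrable (fun x : ℝ => x) ν) {u : ℝ} (hu : u ∈ Icc (0 : ℝ) 1) :
    cdf (marginalMinus μ ν) u = PsiMinus μ ν u / gam μ ν :=
  have : IsProbabilityMeasure (scaledDensity (negDiff μ ν) (gam μ ν)) :=
    hcx.isProbabilityMeasure_marginalMinus hμ hν
  cdf_scaledDensity negDiff_nonneg (intervalIntegrable_negDiff hμ hν) (hcx.gam_pos hμ hν).le hu

end StrictConvexOrder

end Order

section InverseTransform

variable {μ ν : Measure ℝ} [IsProbabilityMeasure μ] [IsProbabilityMeasure ν]

namespace StrictConvexOrder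

lemma phi_eq_monotoneTransport (hcx : StrictConvexOrder μ ν)
    (hμ : Integrable (fun x : ℝ => x) μ) (hν : Integrable (fun x : ℝ => x) ν) {u : ℝ}
    (hu : u ∈ Icc (0 : ℝ) 1) (hcdf : cdf (marginalPlus μ ν) u ∈ Ioo (0 : ℝ) 1) :
    phi μ ν u = monotoneTransport (marginalPlus μ ν) (marginalMinus μ ν) u := by
  have := hcx.isProbabilityMeasure_marginalMinus hμ hν
  have hmem : ∀ᵐ v ∂marginalMinus μ ν, v ∈ Icc (0 : ℝ) 1 :=
    ae_mem_Ioo_scaledDensity.mono fun _ hv => Ioo_subset_Icc_self hv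
  rw [monotoneTransport, quantile_eq_sInf_of_ae_mem_Icc hmem hcdf, phi]
  congr 1
  ext r
  refine and_congr_right fun hr => ?_
  rw [hcx.cdf_marginalPlus hμ hν hu, hcx.cdf_marginalMinus hμ hν hr,
    div_le_div_iff_of_pos_right (hcx.gam_pos hμ hν)]

lemma QIT_eq (hcx : StrictConvexOrder μ ν) (hμ : Integrable (fun x : ℝ => x) μ)
    (hν : Integrable (fun x : ℝ => x) ν) :
    QIT μ ν = (marginalPlus μ ν).map fun u =>
      (u, monotoneTransport (marginalPlus μ ν) (marginalMinus μ ν) u) := by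
  have := hcx.isProbabilityMeasure_marginalPlus hμ hν
  have := hcx.isProbabilityMeasure_marginalMinus hμ hν
  have hmem : ∀ᵐ u ∂marginalPlus μ ν, u ∈ Ioo (0 : ℝ) 1 := ae_mem_Ioo_scaledDensity
  have hphi : phi μ ν =ᵐ[marginalPlus μ ν]
      monotoneTransport (marginalPlus μ ν) (marginalMinus μ ν) := by
    filter_upwards [hmem, ae_cdf_mem_Ioo] with u hu hcdf
    exact hcx.phi_eq_monotoneTransport hμ hν (Ioo_subset_Icc_self hu) hcdf
  have hIoo : ∀ᵐ u ∂marginalPlus μ ν, u ∈ {u | 0 < phi μ ν u ∧ phi μ ν u < 1} := by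
    have hT : ∀ᵐ u ∂marginalPlus μ ν,
        monotoneTransport (marginalPlus μ ν) (marginalMinus μ ν) u ∈ Ioo (0 : ℝ) 1 :=
      ae_of_ae_map (measurable_monotoneTransport _ _).aemeasurable
        (by rw [map_monotoneTransport]; exact ae_mem_Ioo_scaledDensity)
    filter_upwards [hphi, hT] with u h hu
    rwa [← h] at hu
  rw [QIT, Measure.restrict_eq_self_of_ae_mem hIoo]
  exact Measure.map_congr (hphi.mono fun u hu => congrArg (Prod.mk u) hu)

lemma ae_lt_monotoneTransport (hcx : StrictConvexOrder μ ν) (hμ : Integrable (fun x : ℝ => x) μ)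
    (hν : Integrable (fun x : ℝ => x) ν) :
    ∀ᵐ u ∂marginalPlus μ ν, u < monotoneTransport (marginalPlus μ ν) (marginalMinus μ ν) u := by
  have := hcx.isProbabilityMeasure_marginalPlus hμ hν
  have hmem : ∀ᵐ u ∂marginalPlus μ ν, u ∈ Ioo (0 : ℝ) 1 := ae_mem_Ioo_scaledDensity
  filter_upwards [hmem, ae_cdf_mem_Ioo, hcx.ae_integral_diff_pos hμ hν] with u hu hcdf hpos
  have hu' := Ioo_subset_Icc_self hu
  rw [← PsiPlus_sub_PsiMinus hμ hν hu', sub_pos] at hpos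
  refine lt_of_not_ge fun hle => hpos.not_ge ?_
  rwa [monotoneTransport, quantile_le_iff _ hcdf, hcx.cdf_marginalPlus hμ hν hu',
    hcx.cdf_marginalMinus hμ hν hu', div_le_div_iff_of_pos_right (hcx.gam_pos hμ hν)] at hle

lemma QIT_mem (hcx : StrictConvexOrder μ ν) (hμ : Integrable (fun x : ℝ => x) μ)
    (hν : Integrable (fun x : ℝ => x) ν) : QIT μ ν ∈ QSet μ ν := by
  have := hcx.isProbabilityMeasure_marginalPlus hμ hν
  have := hcx.isProbabilityMeasure_marginalMinus hμ hν
  rw [hcx.QIT_eq hμ hν]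
  exact graph_mem_QSet (measurable_monotoneTransport _ _) map_monotoneTransport
    (hcx.ae_lt_monotoneTransport hμ hν)

lemma concordanceLE_QIT (hcx : StrictConvexOrder μ ν) (hμ : Integrable (fun x : ℝ => x) μ)
    (hν : Integrable (fun x : ℝ => x) ν) {Q : Measure (ℝ × ℝ)} (hQ : Q ∈ QSet μ ν) :
    ConcordanceLE Q (QIT μ ν) := by
  have := hcx.isProbabilityMeasure_marginalPlus hμ hν
  have := hcx.isProbabilityMeasure_marginalMinus hμ hν
  rw [hcx.QIT_eq hμ hν]
  exact concordanceLE_graph_of_monotoneOn hQ.2.1 (hQ.2.2.1.trans map_monotoneTransport.symm)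
    (measurable_monotoneTransport _ _) ae_cdf_mem_Ioo (monotoneOn_monotoneTransport _ _)

end StrictConvexOrder

end InverseTransform

section NonincreasingTransform

lemma ae_nonneg_of_monotoneOn_integral {f : ℝ → ℝ} {a b c d : ℝ}
    (hf : IntervalIntegrable f volume a b) (hsub : Icc c d ⊆ uIcc a b)
    (h : MonotoneOn (fun u => ∫ v in a..u, f v) (Icc c d)) : ∀ᵐ u, u ∈ Ioo c d → 0 ≤ f u := by
  filter_upwards [hf.ae_hasDerivAt_integral] with u hder hu
  have hd := hder (hsub (Ioo_subset_Icc_self hu)) a left_mem_uIcc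
  rw [← hd.deriv, ← derivWithin_of_mem_nhds (Icc_mem_nhds hu.1 hu.2)]
  exact h.derivWithin_nonneg

lemma ae_nonpos_of_antitoneOn_integral {f : ℝ → ℝ} {a b c d : ℝ}
    (hf : IntervalIntegrable f volume a b) (hsub : Icc c d ⊆ uIcc a b)
    (h : AntitoneOn (fun u => ∫ v in a..u, f v) (Icc c d)) : ∀ᵐ u, u ∈ Ioo c d → f u ≤ 0 := by
  filter_upwards [hf.ae_hasDerivAt_integral] with u hder hu
  have hd := hder (hsub (Ioo_subset_Icc_self hu)) a left_mem_uIcc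
  rw [← hd.deriv, ← derivWithin_of_mem_nhds (Icc_mem_nhds hu.1 hu.2)]
  exact h.derivWithin_nonpos

variable {μ ν : Measure ℝ} [IsProbabilityMeasure μ] [IsProbabilityMeasure ν]

lemma SingleSignChange.exists_separating_marginals (hs : SingleSignChange μ ν)
    (hμ : Integrable (fun x : ℝ => x) μ) (hν : Integrable (fun x : ℝ => x) ν)
    (hγ : 0 < gam μ ν) :
    ∃ p, (∀ᵐ u ∂marginalPlus μ ν, u < p) ∧ ∀ᵐ u ∂marginalMinus μ ν, p < u := by
  obtain ⟨p, hp, hmono, hanti⟩ := hs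
  have hd := intervalIntegrable_diff hμ hν
  have huIcc : uIcc (0 : ℝ) 1 = Icc 0 1 := uIcc_of_le zero_le_one
  have hleft := ae_nonneg_of_monotoneOn_integral hd
    (huIcc ▸ Icc_subset_Icc_right hp.2.le) hmono
  have hright := ae_nonpos_of_antitoneOn_integral hd
    (huIcc ▸ Icc_subset_Icc_left hp.1.le) hanti
  have hne : ∀ᵐ u, u ≠ p := Measure.ae_ne volume p
  refine ⟨p, (ae_marginalPlus_iff hγ).2 ?_, (ae_marginalMinus_iff hγ).2 ?_⟩
  · filter_upwards [ae_restrict_of_ae hright, ae_restrict_of_ae hne,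
      ae_restrict_mem measurableSet_Ioo] with u hle hup hu hlt
    exact hup.lt_of_le (le_of_not_gt fun hpu => (sub_pos.2 hlt).not_ge (hle ⟨hpu, hu.2⟩))
  · filter_upwards [ae_restrict_of_ae hleft, ae_restrict_of_ae hne,
      ae_restrict_mem measurableSet_Ioo] with u hge hup hu hlt
    exact hup.lt_of_le' (le_of_not_gt fun hpu => (sub_neg.2 hlt).not_ge (hge ⟨hu.1, hpu⟩))

namespace StrictConvexOrder

lemma one_sub_Gam_eq_antitoneTransport (hcx : StrictConvexOrder μ ν)
    (hμ : Integrable (fun x : ℝ => x) μ) (hν : Integrable (fun x : ℝ => x) ν) {u : ℝ}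
    (hu : u ∈ Icc (0 : ℝ) 1) (hcdf : cdf (marginalPlus μ ν) u ∈ Ioo (0 : ℝ) 1) :
    1 - Gam μ ν u = antitoneTransport (marginalPlus μ ν) (marginalMinus μ ν) u := by
  have := hcx.isProbabilityMeasure_marginalMinus hμ hν
  have hreflect : Measurable fun v : ℝ => 1 - v := by fun_prop
  have : IsProbabilityMeasure ((scaledDensity (negDiff μ ν) (gam μ ν)).map fun v => 1 - v) :=
    Measure.isProbabilityMeasure_map (μ := marginalMinus μ ν) hreflect.aemeasurable
  have hmem : ∀ᵐ v ∂(scaledDensity (negDiff μ ν) (gam μ ν)).map fun v => 1 - v,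
      v ∈ Icc (0 : ℝ) 1 :=
    (ae_map_iff hreflect.aemeasurable measurableSet_Icc).2
      (ae_mem_Ioo_scaledDensity.mono fun v hv => ⟨sub_nonneg.2 hv.2.le, sub_le_self _ hv.1.le⟩)
  rw [antitoneTransport, monotoneTransport, marginalMinus_eq_scaledDensity,
    quantile_eq_sInf_of_ae_mem_Icc hmem hcdf, Gam]
  congr 2
  ext r
  refine and_congr_right fun hr => ?_
  rw [hcx.cdf_marginalPlus hμ hν hu, cdf_map_one_sub_scaledDensity negDiff_nonneg
    (intervalIntegrable_negDiff hμ hν) (hcx.gam_pos hμ hν).le hr,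
    div_le_div_iff_of_pos_right (hcx.gam_pos hμ hν)]
  rfl

lemma QNIT_eq (hcx : StrictConvexOrder μ ν) (hμ : Integrable (fun x : ℝ => x) μ)
    (hν : Integrable (fun x : ℝ => x) ν) :
    QNIT μ ν = (marginalPlus μ ν).map fun u =>
      (u, antitoneTransport (marginalPlus μ ν) (marginalMinus μ ν) u) := by
  have := hcx.isProbabilityMeasure_marginalPlus hμ hν
  have := hcx.isProbabilityMeasure_marginalMinus hμ hν
  have hmem : ∀ᵐ u ∂marginalPlus μ ν, u ∈ Ioo (0 : ℝ) 1 := ae_mem_Ioo_scaledDensity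
  have hGam : (fun u => 1 - Gam μ ν u) =ᵐ[marginalPlus μ ν]
      antitoneTransport (marginalPlus μ ν) (marginalMinus μ ν) := by
    filter_upwards [hmem, ae_cdf_mem_Ioo] with u hu hcdf
    exact hcx.one_sub_Gam_eq_antitoneTransport hμ hν (Ioo_subset_Icc_self hu) hcdf
  have hpos : ∀ᵐ u ∂marginalPlus μ ν, u ∈ {u | 0 < Gam μ ν u} := by
    have hT : ∀ᵐ u ∂marginalPlus μ ν,
        antitoneTransport (marginalPlus μ ν) (marginalMinus μ ν) u ∈ Ioo (0 : ℝ) 1 :=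
      ae_of_ae_map (measurable_antitoneTransport _ _).aemeasurable
        (by rw [map_antitoneTransport]; exact ae_mem_Ioo_scaledDensity)
    filter_upwards [hGam, hT] with u h hu
    rw [← h] at hu
    exact sub_lt_self_iff 1 |>.1 hu.2
  rw [QNIT, Measure.restrict_eq_self_of_ae_mem hpos]
  exact Measure.map_congr (hGam.mono fun u hu => congrArg (Prod.mk u) hu)

lemma QNIT_mem (hcx : StrictConvexOrder μ ν) (hμ : Integrable (fun x : ℝ => x) μ)
    (hν : Integrable (fun x : ℝ => x) ν) (hs : SingleSignChange μ ν) : QNIT μ ν ∈ QSet μ ν := by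
  have := hcx.isProbabilityMeasure_marginalPlus hμ hν
  have := hcx.isProbabilityMeasure_marginalMinus hμ hν
  obtain ⟨p, hlt, hgt⟩ := hs.exists_separating_marginals hμ hν (hcx.gam_pos hμ hν)
  have hmap : (marginalPlus μ ν).map (antitoneTransport (marginalPlus μ ν) (marginalMinus μ ν)) =
      marginalMinus μ ν := map_antitoneTransport
  have hT : Measurable (antitoneTransport (marginalPlus μ ν) (marginalMinus μ ν)) :=
    measurable_antitoneTransport _ _
  rw [hcx.QNIT_eq hμ hν]
  refine graph_mem_QSet hT hmap ?_
  rw [← hmap] at hgt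
  filter_upwards [hlt, ae_of_ae_map hT.aemeasurable hgt] with u hu hu'
  exact hu.trans hu'

lemma concordanceLE_of_QNIT (hcx : StrictConvexOrder μ ν) (hμ : Integrable (fun x : ℝ => x) μ)
    (hν : Integrable (fun x : ℝ => x) ν) {Q : Measure (ℝ × ℝ)} (hQ : Q ∈ QSet μ ν) :
    ConcordanceLE (QNIT μ ν) Q := by
  have := hcx.isProbabilityMeasure_marginalPlus hμ hν
  have := hcx.isProbabilityMeasure_marginalMinus hμ hν
  rw [hcx.QNIT_eq hμ hν]
  exact concordanceLE_graph_of_antitoneOn hQ.2.1 (hQ.2.2.1.trans map_antitoneTransport.symm)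
    (measurable_antitoneTransport _ _) ae_cdf_mem_Ioo (antitoneOn_antitoneTransport _ _)

end StrictConvexOrder

end NonincreasingTransform

end ITMC

theorem mainTheorem8 (μ ν : Measure ℝ) [IsProbabilityMeasure μ] [IsProbabilityMeasure ν]
    (hμ : Integrable (fun x : ℝ => x) μ) (hν : Integrable (fun x : ℝ => x) ν)
    (hcx : ITMC.StrictConvexOrder μ ν) :
    (ITMC.QIT μ ν ∈ ITMC.QSet μ ν ∧
      ∀ Q ∈ ITMC.QSet μ ν, ∀ (D : ITMC.Disintegration μ ν Q)
        (DIT : ITMC.Disintegration μ ν (ITMC.QIT μ ν)),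
        (∀ ρ ∈ Iic (1 : ℝ) ∪ Ici 2,
          ITMC.cost ν ρ (ITMC.tildeKernel DIT) ≤ ITMC.cost ν ρ (ITMC.tildeKernel D)) ∧
        (∀ ρ ∈ Icc (1 : ℝ) 2,
          ITMC.cost ν ρ (ITMC.tildeKernel D) ≤ ITMC.cost ν ρ (ITMC.tildeKernel DIT)) ∧
        (∀ ρ ∈ ({1, 2} : Set ℝ),
          ITMC.cost ν ρ (ITMC.tildeKernel DIT) = ITMC.cost ν ρ (ITMC.tildeKernel D))) ∧
    (ITMC.SingleSignChange μ ν →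
      ITMC.QNIT μ ν ∈ ITMC.QSet μ ν ∧
      ∀ Q ∈ ITMC.QSet μ ν, ∀ (D : ITMC.Disintegration μ ν Q)
        (DNIT : ITMC.Disintegration μ ν (ITMC.QNIT μ ν)),
        (∀ ρ ∈ Iic (1 : ℝ) ∪ Ici 2,
          ITMC.cost ν ρ (ITMC.tildeKernel D) ≤ ITMC.cost ν ρ (ITMC.tildeKernel DNIT)) ∧
        (∀ ρ ∈ Icc (1 : ℝ) 2,
          ITMC.cost ν ρ (ITMC.tildeKernel DNIT) ≤ ITMC.cost ν ρ (ITMC.tildeKernel D)) ∧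
        (∀ ρ ∈ ({1, 2} : Set ℝ),
          ITMC.cost ν ρ (ITMC.tildeKernel DNIT) = ITMC.cost ν ρ (ITMC.tildeKernel D))) := by
  have hγ := hcx.gam_pos hμ hν
  have hIT := hcx.QIT_mem hμ hν
  refine ⟨⟨hIT, fun Q hQ D DIT =>
    ITMC.cost_comparison hγ hQ hIT (hcx.concordanceLE_QIT hμ hν hQ) D DIT⟩, fun hs => ?_⟩
  have hNIT := hcx.QNIT_mem hμ hν hs
  refine ⟨hNIT, fun Q hQ D DNIT => ?_⟩
  obtain ⟨hanti, hmono, heq⟩ :=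
    ITMC.cost_comparison hγ hNIT hQ (hcx.concordanceLE_of_QNIT hμ hν hQ) DNIT D
  exact ⟨hanti, hmono, fun ρ hρ => (heq ρ hρ).symm⟩
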